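/- **Setting.** Let $d\ge 1$, let $\Omega\subset\mathbb R^d$ be a bounded open set, let $f\in L^2(\Omega)$ with $f\ge 0$ a.e., and let $\alpha>0$. Write $|A|$ for the Lebesgue measure $\mathcal L^d(A)$. For an open bounded $D\subset\mathbb R^d$, $a>0$ and $n\in\mathbb N$, let $\mathcal A(a,n)(D)$ be the family of all sets $\Sigma=\overline D\cap\bigcup_{i=1}^n\overline{B(x_i,r)}$ with $r=a\,n^{-1/d}$ and centres $x_i$ in the open $r$-neighbourhood of $D$. For such $\Sigma$ and $h\in L^2(D)$, $h\ge0$, let $F(\Sigma,h,D)=\int_D h\,u\,d\mathcal L^d$, where $u\in H^1_0(D\setminus\Sigma)$ is the weak solution of $-\Delta u=h$ in $D\setminus\Sigma$, $u=0$ on $\Sigma\cup\partial D$. With $I^d=(0,1)^d$, define for $a>0$ $$\theta(a)=\inf\Big\{\liminf_{n\to\infty}n^{2/d}F(\Sigma_n,1,I^d)\ :\ \Sigma_n\in\mathcal A(a,n)(I^d)\Big\},$$ and put $\theta^-(a)=\sup_{b>a}\theta(b)$ for $a\ge0$, and $t_1=\inf\{t>0:\theta(t)=0\}$. For a probability measure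 $\mu$ on $\overline\Omega$, with $\mu_a$ the density of its absolutely continuous part, let $$F(\mu)=\int_\Omega\frac{f^2}{\mu_a^{2/d}}\,\theta^-\big(\alpha\mu_a^{1/d}\big)\,d\mathcal L^d\in[0,+\infty],$$ where the integrand is $0$ where $f=0$. Let $g_\alpha(x)=x^{-2/d}\theta(\alpha x^{1/d})$ for $x>0$ and $g_\alpha(x)=+\infty$ for $x\le 0$. Let $\partial g_\alpha$ be its subdifferential in the sense of convex analysis, that is, $p\in\partial g_\alpha(z)$ iff $g_\alpha(z)$ is finite and $g_\alpha(y)\ge g_\alpha(z)+p(y-z)$ for all $y\in\mathbb R$. For $s\in\mathbb R$ let $(-\partial g_\alpha)^{-1}(s)=\{z\ge 0: s\in-\partial g_\alpha(z)\}$. **Theorem 2.3.** Assume $\alpha<|\{x\in\Omega:f(x)>0\}|^{1/d}\,t_1$ (that is, $\alpha<|\Omega|^{1/d}t_1$ when $f>0$ a.e.). Then every minimizer $\mu$ of $F$ over the probability measures on $\overline\Omega$ is absolutely continuous with respect to the Lebesgue measure on $\Omega$, and its density $\mu_\alpha$ has the following properties. * There is a constant $c>0$ such that $$\mu_\alpha(x)\in(-\partial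 g_\alpha)^{-1}\Big(\frac{c}{f^2(x)}\Big)\quad\text{for a.e. }x\in\Omega\text{ with }f(x)>0,$$ and $\mu_\alpha(x)=0$ for a.e. $x\in\Omega$ with $f(x)=0$. * $\mu_\alpha\le t_\alpha:=(t_1/\alpha)^d$ a.e. in $\Omega$. -/

import Mathlib

open MeasureTheory Filter Set
open scoped ENNReal Topology ContDiff Gradient

noncomputable section

namespace ComplianceLocation

/-- The ambient Hilbert space of pairs (function, vector field) in `L² × L²` over `ℝ^d`, whose norm
on the pairs `(u, ∇u)` is the usual `H¹` norm. -/
abbrev PairSpace (d : ℕ) : Type :=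
  WithLp 2 (Lp ℝ 2 (volume : Measure (EuclideanSpace ℝ (Fin d))) ×
    Lp (EuclideanSpace ℝ (Fin d)) 2 (volume : Measure (EuclideanSpace ℝ (Fin d))))

/-- The pairs `(φ, ∇φ)`, where `φ` is smooth and compactly supported in `U`. -/
def testPairs {d : ℕ} (U : Set (EuclideanSpace ℝ (Fin d))) : Set (PairSpace d) :=
  {p | ∃ φ : EuclideanSpace ℝ (Fin d) → ℝ,
    ContDiff ℝ ∞ φ ∧ HasCompactSupport φ ∧ tsupport φ ⊆ U ∧
    p.fst =ᵐ[volume] φ ∧ p.snd =ᵐ[volume] ∇ φ}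

/-- The space `H¹₀(U)`, for `U` open: the closure of `C_c^∞(U)` in the `H¹` norm. A function `u` is
represented by the pair `(u, ∇u)`, extended by zero outside of `U`. -/
def H10 {d : ℕ} (U : Set (EuclideanSpace ℝ (Fin d))) : Submodule ℝ (PairSpace d) :=
  (Submodule.span ℝ (testPairs U)).topologicalClosure

/-- `u` is the weak solution of `-Δu = f` in `Ω \ S`, `u = 0` on `S ∪ ∂Ω`. -/
def IsWeakSolution {d : ℕ} (Ω S : Set (EuclideanSpace ℝ (Fin d)))
    (f : EuclideanSpace ℝ (Fin d) → ℝ) (u : PairSpace d) : Prop :=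
  u ∈ H10 (Ω \ S) ∧
    ∀ φ ∈ H10 (Ω \ S),
      ∫ x in Ω, inner ℝ (u.snd x) (φ.snd x) = ∫ x in Ω, f x * φ.fst x

open Classical in
/-- The compliance `∫_Ω f u`, where `u` is the weak solution above. For `Ω` bounded and open, `S`
closed and `f ∈ L²(Ω)` that solution exists and is unique, so the value `0` of the other branch
is not used. -/
def compliance {d : ℕ} (S : Set (EuclideanSpace ℝ (Fin d)))
    (f : EuclideanSpace ℝ (Fin d) → ℝ) (Ω : Set (EuclideanSpace ℝ (Fin d))) : ℝ :=
  if h : ∃ u : PairSpace d, IsWeakSolution Ω S f u then ∫ x in Ω, f x * h.choose.fst x else 0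

/-- The admissible Dirichlet regions: traces on the closure of `Ω` of unions of `n` closed balls of
radius `r = α n^{-1/d}` with centres in the `r`-neighbourhood of `Ω`. -/
def admissible {d : ℕ} (α : ℝ) (n : ℕ) (Ω : Set (EuclideanSpace ℝ (Fin d))) :
    Set (Set (EuclideanSpace ℝ (Fin d))) :=
  {S | ∃ x : Fin n → EuclideanSpace ℝ (Fin d),
    (∀ i, x i ∈ Metric.thickening (α * (n : ℝ) ^ (-(1 / (d : ℝ)))) Ω) ∧
    S = closure Ω ∩ ⋃ i, Metric.closedBall (x i) (α * (n : ℝ) ^ (-(1 / (d : ℝ))))}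

/-- The open unit cube `(0,1)^d`. -/
def unitCube (d : ℕ) : Set (EuclideanSpace ℝ (Fin d)) := {x | ∀ i, x i ∈ Ioo (0 : ℝ) 1}

/-- `θ(α)`, the infimum of `liminf_n n^{2/d} F(Σ_n, 1, I^d)` over admissible sequences. It is
meant for `α > 0`. -/
def theta (d : ℕ) (α : ℝ) : ℝ≥0∞ :=
  ⨅ (S : ℕ → Set (EuclideanSpace ℝ (Fin d))) (_ : ∀ n, S n ∈ admissible α n (unitCube d)),
    liminf (fun n : ℕ =>
      ENNReal.ofReal ((n : ℝ) ^ (2 / (d : ℝ)) * compliance (S n) (fun _ => 1) (unitCube d))) atTop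

/-- `θ⁻(α) = sup {θ(β) | β > α}`, the lower semicontinuous envelope of the nonincreasing `θ`. -/
def thetaMinus (d : ℕ) (α : ℝ) : ℝ≥0∞ := ⨆ (β : ℝ) (_ : α < β), theta d β

/-- The first vanishing point `t₁` of `θ`. -/
def t₁ (d : ℕ) : ℝ := sInf {t : ℝ | 0 < t ∧ theta d t = 0}

/-- The limit functional `F(μ) = ∫_Ω f² μ_a^{-2/d} θ⁻(α μ_a^{1/d})`, where `μ_a` is the density of the
absolutely continuous part of `μ`. (In `ℝ≥0∞`, `a / 0 = ∞` for `a ≠ 0` and `0 / 0 = 0`.) -/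
def limitFunctional {d : ℕ} (α : ℝ) (f : EuclideanSpace ℝ (Fin d) → ℝ)
    (Ω : Set (EuclideanSpace ℝ (Fin d))) (μ : Measure (EuclideanSpace ℝ (Fin d))) : ℝ≥0∞ :=
  ∫⁻ x in Ω, ENNReal.ofReal (f x ^ 2) / (μ.rnDeriv volume x) ^ (2 / (d : ℝ)) *
    thetaMinus d (α * (μ.rnDeriv volume x).toReal ^ (1 / (d : ℝ)))

/-- `μ` is a probability measure on the closure of `Ω`. -/
def IsProbOn {d : ℕ} (Ω : Set (EuclideanSpace ℝ (Fin d)))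
    (μ : Measure (EuclideanSpace ℝ (Fin d))) : Prop :=
  IsProbabilityMeasure μ ∧ μ (closure Ω)ᶜ = 0

/-- `μ` minimizes the limit functional among the probability measures on the closure of `Ω`. -/
def IsMinimizer {d : ℕ} (α : ℝ) (f : EuclideanSpace ℝ (Fin d) → ℝ)
    (Ω : Set (EuclideanSpace ℝ (Fin d))) (μ : Measure (EuclideanSpace ℝ (Fin d))) : Prop :=
  IsProbOn Ω μ ∧ ∀ ν, IsProbOn Ω ν → limitFunctional α f Ω μ ≤ limitFunctional α f Ω ν

/-- `g_α(x) = x^{-2/d} θ(α x^{1/d})` for `x > 0`, extended by `+∞` to `x ≤ 0`. -/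
def g (d : ℕ) (α x : ℝ) : EReal :=
  if 0 < x then
    ((ENNReal.ofReal (x ^ (-(2 / (d : ℝ)))) * theta d (α * x ^ (1 / (d : ℝ))) : ℝ≥0∞) : EReal)
  else ⊤

/-- The subdifferential of convex analysis of an extended-real-valued function on the line. -/
def subdifferential (h : ℝ → EReal) (x : ℝ) : Set ℝ :=
  {p | h x ≠ ⊤ ∧ h x ≠ ⊥ ∧ ∀ y, h x + ((p * (y - x) : ℝ) : EReal) ≤ h y}

/-- `(-∂h)^{-1}(s)`, the set of the `z ≥ 0` with `s ∈ -∂h(z)`. -/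
def negSubdiffInv (h : ℝ → EReal) (s : ℝ) : Set ℝ :=
  {z | 0 ≤ z ∧ -s ∈ subdifferential h z}

end ComplianceLocation

end

open MeasureTheory Filter Set
open scoped ENNReal Topology ContDiff Gradient

noncomputable section

namespace ComplianceLocation

/-! This is a resource allocation problem: distribute a unit mass so as to minimize `∫ W h(ρ)`, with
weight `W = f²` and profile `h(y) = y^{-2/d} θ⁻(α y^{1/d})`, which is nonincreasing but not known to
be convex. Only the absolutely continuous part of `μ` inside `Ω` enters the functional, so mass
placed elsewhere is wasted: spread uniformly over `Ω` it cannot raise the value, hence by minimality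
it leaves it unchanged. The factor `y^{-2/d}` makes `h` strictly decreasing as long as it is
positive, so `h(ρ)` would vanish a.e. on `{f > 0}`. This requires `ρ ≥ (t₁/α)^d` there, and by the
bound on `α` such a density has mass above one (`one_lt_lintegral_of_profile_eq_zero`). So `μ` has a
density on `Ω`.

For this density a multiplier rule holds without convexity. Mass may be moved between two sets of
points, and since Lebesgue measure has no atoms the gain and the loss can be made equal. Hence there
is a price `c` at which, for a.e. `x`, `ρ(x)` minimizes `W(x) h(y) + c y` over `y ≥ 0`
(`exists_multiplier`). Division by `f²` gives the subdifferential inclusion; comparison with `y = 0`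
where `f = 0`, and with `y = (t₁/α)^d`, where `h` vanishes, gives the remaining claims.

The subdifferential involves `θ` and the functional `θ⁻`, so `θ` must be shown to be finite
(`theta_lt_top`) and right continuous (`theta_eq_thetaMinus`). By duality the compliance is the best
`M` in `(∫ φ)² ≤ M ∫ |∇φ|²`, a quantity monotone in the domain, well behaved under scaling and
additive over disjoint open pieces. A configuration for a radius `b` slightly above `a` is shrunk
into a slightly smaller cube; a few extra balls build a wall around it and a lattice in the
remaining shell. The shell costs only `O(δ)`, because a set of volume `v` that stays away from the
lattice `K⁻¹ ℤ^d` has `M = O(v / K²)` (`exists_torsionBound_lattice`). -/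

/-- Smooth functions with compact support in `U`. -/
def IsTest {d : ℕ} (U : Set (EuclideanSpace ℝ (Fin d))) (φ : EuclideanSpace ℝ (Fin d) → ℝ) : Prop :=
  ContDiff ℝ ∞ φ ∧ HasCompactSupport φ ∧ tsupport φ ⊆ U

/-- The inequality `(∫ φ)² ≤ M ∫ |∇φ|²` for all test functions on `U`. -/
def TorsionBound {d : ℕ} (U : Set (EuclideanSpace ℝ (Fin d))) (M : ℝ) : Prop :=
  ∀ φ, IsTest U φ → (∫ x, φ x) ^ 2 ≤ M * ∫ x, ‖∇ φ x‖ ^ 2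

/-! ### Test functions and their closure `H10`. -/

section Test

variable {d : ℕ} {U V : Set (EuclideanSpace ℝ (Fin d))} {φ ψ : EuclideanSpace ℝ (Fin d) → ℝ}

lemma IsTest.mono (h : IsTest U φ) (hUV : U ⊆ V) : IsTest V φ :=
  ⟨h.1, h.2.1, h.2.2.trans hUV⟩

lemma TorsionBound.anti {M : ℝ} (h : TorsionBound V M) (hUV : U ⊆ V) : TorsionBound U M :=
  fun φ hφ => h φ (hφ.mono hUV)

lemma IsTest.differentiable (h : IsTest U φ) : Differentiable ℝ φ :=
  h.1.differentiable (by simp)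

lemma IsTest.zero : IsTest U (0 : EuclideanSpace ℝ (Fin d) → ℝ) :=
  ⟨contDiff_const, HasCompactSupport.zero, by simp [tsupport]⟩

lemma IsTest.add (h : IsTest U φ) (h' : IsTest U ψ) : IsTest U (φ + ψ) :=
  ⟨h.1.add h'.1, h.2.1.add h'.2.1, (tsupport_add φ ψ).trans (union_subset h.2.2 h'.2.2)⟩

lemma IsTest.const_smul (h : IsTest U φ) (c : ℝ) : IsTest U (c • φ) :=
  ⟨h.1.const_smul c, h.2.1.smul_left (f := fun _ => c),
    (closure_mono (Function.support_const_smul_subset c φ)).trans h.2.2⟩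

lemma gradient_eq_toDual_symm (φ : EuclideanSpace ℝ (Fin d) → ℝ) :
    ∇ φ = fun x => (InnerProductSpace.toDual ℝ _).symm (fderiv ℝ φ x) := rfl

lemma norm_gradient (φ : EuclideanSpace ℝ (Fin d) → ℝ) (x : EuclideanSpace ℝ (Fin d)) :
    ‖∇ φ x‖ = ‖fderiv ℝ φ x‖ := by
  simp [gradient_eq_toDual_symm]

lemma IsTest.continuous_gradient (h : IsTest U φ) : Continuous (∇ φ) := by
  rw [gradient_eq_toDual_symm]
  exact (LinearIsometryEquiv.continuous _).comp (h.1.continuous_fderiv (by simp))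

lemma IsTest.hasCompactSupport_gradient (h : IsTest U φ) : HasCompactSupport (∇ φ) := by
  rw [gradient_eq_toDual_symm]
  exact (h.2.1.fderiv ℝ).comp_left (map_zero _)

lemma IsTest.memLp (h : IsTest U φ) : MemLp φ 2 :=
  h.1.continuous.memLp_of_hasCompactSupport h.2.1

lemma IsTest.memLp_gradient (h : IsTest U φ) : MemLp (∇ φ) 2 :=
  h.continuous_gradient.memLp_of_hasCompactSupport h.hasCompactSupport_gradient

lemma IsTest.integrable (h : IsTest U φ) : Integrable φ :=
  h.1.continuous.integrable_of_hasCompactSupport h.2.1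

lemma IsTest.integrable_sq_gradient (h : IsTest U φ) : Integrable (fun x => ‖∇ φ x‖ ^ 2) :=
  h.memLp_gradient.integrable_norm_pow (by simp)

lemma IsTest.eq_zero (h : IsTest U φ) {x : EuclideanSpace ℝ (Fin d)} (hx : x ∉ U) : φ x = 0 :=
  image_eq_zero_of_notMem_tsupport fun hx' => hx (h.2.2 hx')

lemma IsTest.gradient_eq_zero (h : IsTest U φ) {x : EuclideanSpace ℝ (Fin d)} (hx : x ∉ U) :
    ∇ φ x = 0 := by
  rw [gradient_eq_toDual_symm]
  simp [fderiv_of_notMem_tsupport (𝕜 := ℝ) fun hx' => hx (h.2.2 hx')]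

/-- The pair `(φ, ∇φ)`. -/
def IsTest.pair (h : IsTest U φ) : PairSpace d :=
  WithLp.toLp 2 (h.memLp.toLp φ, h.memLp_gradient.toLp (∇ φ))

lemma IsTest.pair_mem (h : IsTest U φ) : h.pair ∈ testPairs U :=
  ⟨φ, h.1, h.2.1, h.2.2, h.memLp.coeFn_toLp, h.memLp_gradient.coeFn_toLp⟩

lemma IsTest.pair_mem_H10 (h : IsTest U φ) : h.pair ∈ H10 U :=
  Submodule.le_topologicalClosure _ (Submodule.subset_span h.pair_mem)

/-- Test functions already form a vector space, so elements of the span in `H10` are again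
represented by single test functions. -/
lemma mem_testPairs_of_mem_span {p : PairSpace d} (hp : p ∈ Submodule.span ℝ (testPairs U)) :
    p ∈ testPairs U := by
  induction hp using Submodule.span_induction with
  | mem x h => exact h
  | zero =>
    have h0 : IsTest U (0 : EuclideanSpace ℝ (Fin d) → ℝ) := IsTest.zero
    refine ⟨0, h0.1, h0.2.1, h0.2.2, Lp.coeFn_zero _ _ _, ?_⟩
    refine (Lp.coeFn_zero _ _ _).trans (Eventually.of_forall fun x => ?_)
    exact (gradient_const (F := EuclideanSpace ℝ (Fin d)) (𝕜 := ℝ) x 0).symm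
  | add x y _ _ hx hy =>
    obtain ⟨φ, h1, h2, h3, h4, h5⟩ := hx
    obtain ⟨ψ, h1', h2', h3', h4', h5'⟩ := hy
    have hφ : IsTest U φ := ⟨h1, h2, h3⟩
    have hψ : IsTest U ψ := ⟨h1', h2', h3'⟩
    refine ⟨φ + ψ, (hφ.add hψ).1, (hφ.add hψ).2.1, (hφ.add hψ).2.2,
      (Lp.coeFn_add _ _).trans (h4.add h4'), (Lp.coeFn_add _ _).trans ?_⟩
    filter_upwards [h5, h5'] with z hz hz'
    refine (congrArg₂ (· + ·) hz hz').trans ?_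
    simp only [gradient_eq_toDual_symm]
    rw [fderiv_add (hφ.differentiable z) (hψ.differentiable z), map_add]
  | smul c x _ hx =>
    obtain ⟨φ, h1, h2, h3, h4, h5⟩ := hx
    have hφ : IsTest U φ := ⟨h1, h2, h3⟩
    refine ⟨c • φ, (hφ.const_smul c).1, (hφ.const_smul c).2.1, (hφ.const_smul c).2.2,
      (Lp.coeFn_smul _ _).trans (h4.const_smul c), (Lp.coeFn_smul _ _).trans ?_⟩
    filter_upwards [h5] with z hz
    refine (congrArg (c • ·) hz).trans ?_
    simp only [gradient_eq_toDual_symm]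
    rw [fderiv_const_smul (hφ.differentiable z)]
    simp

/-- A closed property of pairs that holds for the test functions holds on `H¹₀`. -/
lemma H10_induction {P : PairSpace d → Prop} (hP : IsClosed {p | P p})
    (h : ∀ p : PairSpace d, ∀ φ, IsTest U φ → p.fst =ᵐ[volume] φ → p.snd =ᵐ[volume] ∇ φ → P p)
    {p : PairSpace d} (hp : p ∈ H10 U) : P p := by
  have hp' : p ∈ closure (Submodule.span ℝ (testPairs U) : Set (PairSpace d)) := hp
  refine closure_minimal (fun q hq => ?_) hP hp'
  obtain ⟨φ, h1, h2, h3, h4, h5⟩ := mem_testPairs_of_mem_span hq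
  exact h q φ ⟨h1, h2, h3⟩ h4 h5

end Test

/-! ### Dirichlet form and mean value as continuous forms on pairs. -/

section Forms

variable {d : ℕ} (Ω : Set (EuclideanSpace ℝ (Fin d)))

/-- Restriction of the first component to `Ω`. -/
def restrictFst : PairSpace d →L[ℝ] Lp ℝ 2 (volume.restrict Ω) :=
  (LpToLpRestrictCLM _ ℝ ℝ volume 2 Ω).comp (WithLp.fstL 2 ℝ _ _)

/-- Restriction of the second component to `Ω`. -/
def restrictSnd : PairSpace d →L[ℝ] Lp (EuclideanSpace ℝ (Fin d)) 2 (volume.restrict Ω) :=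
  (LpToLpRestrictCLM _ (EuclideanSpace ℝ (Fin d)) ℝ volume 2 Ω).comp (WithLp.sndL 2 ℝ _ _)

lemma restrictFst_coeFn (p : PairSpace d) : restrictFst Ω p =ᵐ[volume.restrict Ω] p.fst :=
  LpToLpRestrictCLM_coeFn ℝ Ω p.fst

lemma restrictSnd_coeFn (p : PairSpace d) : restrictSnd Ω p =ᵐ[volume.restrict Ω] p.snd :=
  LpToLpRestrictCLM_coeFn ℝ Ω p.snd

lemma inner_restrictSnd (p q : PairSpace d) :
    inner ℝ (restrictSnd Ω p) (restrictSnd Ω q) = ∫ x in Ω, inner ℝ (p.snd x) (q.snd x) := by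
  rw [L2.inner_def]
  refine integral_congr_ae ?_
  filter_upwards [restrictSnd_coeFn Ω p, restrictSnd_coeFn Ω q] with x h1 h2
  rw [h1, h2]

/-- The functional `p ↦ ∫_Ω p.fst`. -/
def meanForm [IsFiniteMeasure (volume.restrict Ω)] : PairSpace d →L[ℝ] ℝ :=
  (innerSL ℝ ((memLp_const (1 : ℝ)).toLp (μ := volume.restrict Ω) (p := 2) (fun _ => 1))).comp
    (restrictFst Ω)

lemma meanForm_apply [IsFiniteMeasure (volume.restrict Ω)] (p : PairSpace d) :
    meanForm Ω p = ∫ x in Ω, p.fst x := by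
  simp only [meanForm, ContinuousLinearMap.comp_apply, innerSL_apply_apply]
  rw [L2.inner_def]
  refine integral_congr_ae ?_
  filter_upwards [restrictFst_coeFn Ω p,
    (memLp_const (1 : ℝ)).coeFn_toLp (μ := volume.restrict Ω) (p := 2)] with x h1 h2
  rw [h1, h2]; simp

variable {Ω} {U : Set (EuclideanSpace ℝ (Fin d))} {φ : EuclideanSpace ℝ (Fin d) → ℝ}

lemma norm_sq_restrictSnd_of_test (hΩ : MeasurableSet Ω) (hU : U ⊆ Ω) (hφ : IsTest U φ)
    {p : PairSpace d} (hp : p.snd =ᵐ[volume] ∇ φ) :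
    ‖restrictSnd Ω p‖ ^ 2 = ∫ x, ‖∇ φ x‖ ^ 2 := by
  rw [← real_inner_self_eq_norm_sq, inner_restrictSnd]
  rw [← integral_indicator hΩ]
  refine integral_congr_ae ?_
  filter_upwards [hp] with x hx
  by_cases h : x ∈ Ω
  · rw [indicator_of_mem h, hx, real_inner_self_eq_norm_sq]
  · rw [indicator_of_notMem h, hφ.gradient_eq_zero fun h' => h (hU h')]; simp

lemma meanForm_of_test [IsFiniteMeasure (volume.restrict Ω)] (hΩ : MeasurableSet Ω) (hU : U ⊆ Ω)
    (hφ : IsTest U φ) {p : PairSpace d} (hp : p.fst =ᵐ[volume] φ) :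
    meanForm Ω p = ∫ x, φ x := by
  rw [meanForm_apply, ← integral_indicator hΩ]
  refine integral_congr_ae ?_
  filter_upwards [hp] with x hx
  by_cases h : x ∈ Ω
  · rw [indicator_of_mem h, hx]
  · rw [indicator_of_notMem h, hφ.eq_zero fun h' => h (hU h')]

lemma norm_sq_fst_of_test {p : PairSpace d} (hp : p.fst =ᵐ[volume] φ) :
    ‖p.fst‖ ^ 2 = ∫ x, φ x ^ 2 := by
  rw [← real_inner_self_eq_norm_sq, L2.inner_def]
  refine integral_congr_ae ?_
  filter_upwards [hp] with x hx
  rw [hx, real_inner_self_eq_norm_sq]; simp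

lemma norm_sq_snd_of_test {p : PairSpace d} (hp : p.snd =ᵐ[volume] ∇ φ) :
    ‖p.snd‖ ^ 2 = ∫ x, ‖∇ φ x‖ ^ 2 := by
  rw [← real_inner_self_eq_norm_sq, L2.inner_def]
  refine integral_congr_ae ?_
  filter_upwards [hp] with x hx
  rw [hx, real_inner_self_eq_norm_sq]

end Forms

/-! ### Compliance as the optimal torsion constant. -/

section Variational

variable {d : ℕ} {Ω S : Set (EuclideanSpace ℝ (Fin d))}

lemma IsWeakSolution.meanForm_eq [IsFiniteMeasure (volume.restrict Ω)] {u : PairSpace d}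
    (hu : IsWeakSolution Ω S (fun _ => 1) u) {v : PairSpace d} (hv : v ∈ H10 (Ω \ S)) :
    meanForm Ω v = inner ℝ (restrictSnd Ω u) (restrictSnd Ω v) := by
  rw [inner_restrictSnd, hu.2 v hv, meanForm_apply]
  simp

/-- The bound passes to `u` by density. Testing the equation with `u` gives `∫ u = ∫ |∇u|²`, so `(∫
u)² ≤ M ∫ u`. -/
lemma compliance_le_of_torsionBound [IsFiniteMeasure (volume.restrict Ω)]
    (hΩ : MeasurableSet Ω) {M : ℝ} (hM : 0 ≤ M) (h : TorsionBound (Ω \ S) M) :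
    compliance S (fun _ => 1) Ω ≤ M := by
  unfold compliance
  split_ifs with hex
  · have hu := hex.choose_spec
    set u := hex.choose
    have hmem := hu.1
    have h1 : (meanForm Ω u) ^ 2 ≤ M * ‖restrictSnd Ω u‖ ^ 2 := by
      refine H10_induction (P := fun p => (meanForm Ω p) ^ 2 ≤ M * ‖restrictSnd Ω p‖ ^ 2)
        (isClosed_le (by fun_prop) (by fun_prop)) (fun p φ hφ h1 h2 => ?_) hmem
      rw [meanForm_of_test hΩ sdiff_subset hφ h1, norm_sq_restrictSnd_of_test hΩ sdiff_subset hφ h2]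
      exact h φ hφ
    have h2 : meanForm Ω u = ‖restrictSnd Ω u‖ ^ 2 := by
      rw [hu.meanForm_eq hmem, real_inner_self_eq_norm_sq]
    rw [meanForm_apply] at h1 h2
    simp only [one_mul]
    rw [← h2] at h1
    by_contra! hlt
    nlinarith
  · exact hM

lemma compliance_nonneg [IsFiniteMeasure (volume.restrict Ω)] :
    0 ≤ compliance S (fun _ => 1) Ω := by
  unfold compliance
  split_ifs with hex
  · have hu := hex.choose_spec
    have h2 := hu.meanForm_eq hu.1
    rw [real_inner_self_eq_norm_sq, meanForm_apply] at h2
    simp only [one_mul]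
    rw [h2]; positivity
  · exact le_rfl

/-- Existence of the weak solution, given a Poincaré inequality. -/
lemma exists_isWeakSolution [IsFiniteMeasure (volume.restrict Ω)] (hΩ : MeasurableSet Ω) {C : ℝ}
    (hC : 0 ≤ C) (hP : ∀ φ, IsTest (Ω \ S) φ → ∫ x, φ x ^ 2 ≤ C * ∫ x, ‖∇ φ x‖ ^ 2) :
    ∃ u : PairSpace d, IsWeakSolution Ω S (fun _ => 1) u := by
  let H := H10 (Ω \ S)
  have hcl : IsClosed (H : Set (PairSpace d)) := Submodule.isClosed_topologicalClosure _
  have : CompleteSpace H := hcl.completeSpace_coe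
  let R : H →L[ℝ] _ := (restrictSnd Ω).comp H.subtypeL
  let B : H →L[ℝ] H →L[ℝ] ℝ := (innerSL ℝ).bilinearComp R R
  have hB : ∀ v w, B v w = inner ℝ (restrictSnd Ω v) (restrictSnd Ω w) := fun v w => rfl
  have hco : IsCoercive B := by
    refine ⟨1 / (C + 1), by positivity, fun v => ?_⟩
    have key : ‖(v : PairSpace d)‖ ^ 2 ≤ (C + 1) * ‖restrictSnd Ω v‖ ^ 2 := by
      refine H10_induction (P := fun p => ‖p‖ ^ 2 ≤ (C + 1) * ‖restrictSnd Ω p‖ ^ 2)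
        (isClosed_le (by fun_prop) (by fun_prop)) (fun p φ hφ h1 h2 => ?_) v.2
      rw [norm_sq_restrictSnd_of_test hΩ sdiff_subset hφ h2, WithLp.prod_norm_sq_eq_of_L2,
        norm_sq_fst_of_test h1, norm_sq_snd_of_test h2]
      linarith [hP φ hφ]
    rw [hB, real_inner_self_eq_norm_sq]
    have : ‖v‖ = ‖(v : PairSpace d)‖ := rfl
    rw [this, div_mul_eq_mul_div, div_mul_eq_mul_div, div_le_iff₀ (by positivity)]
    linarith
  let ℓ : H →L[ℝ] ℝ := (meanForm Ω).comp H.subtypeL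
  let u : H := hco.continuousLinearEquivOfBilin.symm ((InnerProductSpace.toDual ℝ H).symm ℓ)
  refine ⟨u, u.2, fun v hv => ?_⟩
  have h1 : B u ⟨v, hv⟩ = ℓ ⟨v, hv⟩ := by
    rw [← IsCoercive.continuousLinearEquivOfBilin_apply hco]
    simp [u]
  have h2 : ℓ ⟨v, hv⟩ = meanForm Ω v := rfl
  rw [hB, h2, inner_restrictSnd, meanForm_apply] at h1
  simpa using h1

/-- Cauchy–Schwarz in `∫ φ = ∫ ∇u · ∇φ`. Unlike the upper bound, this needs a weak solution to
exist, since the default value `0` would make it false. -/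
lemma torsionBound_compliance [IsFiniteMeasure (volume.restrict Ω)] (hΩ : MeasurableSet Ω) {C : ℝ}
    (hC : 0 ≤ C) (hP : ∀ φ, IsTest (Ω \ S) φ → ∫ x, φ x ^ 2 ≤ C * ∫ x, ‖∇ φ x‖ ^ 2) :
    TorsionBound (Ω \ S) (compliance S (fun _ => 1) Ω) := by
  intro φ hφ
  have hex := exists_isWeakSolution hΩ hC hP
  unfold compliance
  rw [dif_pos hex]
  have hu := hex.choose_spec
  set u := hex.choose
  have h1 := hu.meanForm_eq hu.1
  have h2 := hu.meanForm_eq hφ.pair_mem_H10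
  rw [real_inner_self_eq_norm_sq, meanForm_apply] at h1
  rw [meanForm_of_test hΩ sdiff_subset hφ (p := hφ.pair) hφ.memLp.coeFn_toLp] at h2
  have h3 := norm_sq_restrictSnd_of_test hΩ sdiff_subset hφ
    (p := hφ.pair) hφ.memLp_gradient.coeFn_toLp
  simp only [one_mul]
  rw [h1, h2, ← h3, ← mul_pow]
  exact sq_le_sq' (by linarith [neg_le_of_abs_le (abs_real_inner_le_norm
    (restrictSnd Ω u) (restrictSnd Ω hφ.pair))]) (real_inner_le_norm _ _)

end Variational

/-! ### A periodic bump with bounded corrector. -/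

section Periodic

/-- A continuous periodic function `η` of mean one, concentrated near the integers, and a bounded
primitive `S` of `1 - η`. -/
lemma exists_periodic_bump {τ : ℝ} (hτ : 0 < τ) :
    ∃ (η S : ℝ → ℝ) (C : ℝ), 1 ≤ C ∧ Continuous η ∧ (∀ x, |η x| ≤ C) ∧ (∀ x, |S x| ≤ C) ∧
      (∀ x, HasDerivAt S (1 - η x) x) ∧ ∀ x, η x ≠ 0 → |x - round x| ≤ τ := by
  -- Every point is within `1/2` of an integer, so a larger `τ` imposes nothing; below `1/2` the
  -- cosine is monotone on the range used.
  wlog hτ2 : τ < 1 / 2 generalizing τ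
  · obtain ⟨η, S, C, h1, h2, h3, h4, h5, h6⟩ := this (τ := 1 / 4) (by norm_num) (by norm_num)
    exact ⟨η, S, C, h1, h2, h3, h4, h5, fun x hx => (h6 x hx).trans (by linarith)⟩
  set q := Real.cos (2 * Real.pi * τ) with hqdef
  have hq : q < 1 := by
    have := Real.cos_lt_cos_of_nonneg_of_le_pi (x := 0) (y := 2 * Real.pi * τ) le_rfl
      (by nlinarith [Real.pi_pos]) (by have := Real.pi_pos; positivity)
    simpa using this
  -- The truncation level `q` makes `b` vanish at distance at least `τ` from the integers.
  set b : ℝ → ℝ := fun x => max 0 (Real.cos (2 * Real.pi * x) - q) with hb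
  have hbc : Continuous b := by fun_prop
  have hb0 : ∀ x, 0 ≤ b x := fun x => le_max_left _ _
  have hbp : Function.Periodic b 1 := by
    intro x
    simp only [b]
    rw [mul_add, mul_one, Real.cos_add_two_pi]
  set m := ∫ x in (0 : ℝ)..1, b x with hmdef
  have hm : 0 < m := by
    refine intervalIntegral.integral_pos one_pos hbc.continuousOn (fun x _ => hb0 x)
      ⟨0, by simp, ?_⟩
    simp [b, hq]
  set η : ℝ → ℝ := fun x => b x / m
  have hηc : Continuous η := by fun_prop
  have hηp : Function.Periodic η 1 := fun x => by simp only [η]; rw [hbp x]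
  set S : ℝ → ℝ := fun x => ∫ t in (0 : ℝ)..x, (1 - η t)
  have hc1 : Continuous fun t => 1 - η t := by fun_prop
  have hSd : ∀ x, HasDerivAt S (1 - η x) x := fun x => hc1.integral_hasStrictDerivAt 0 x |>.hasDerivAt
  have hSc : Continuous S := continuous_iff_continuousAt.2 fun x => (hSd x).continuousAt
  -- The mean of `1 - η` over a period is zero, so its primitive is periodic and therefore bounded.
  have hSp : Function.Periodic S 1 := by
    intro x
    have h1 : S (x + 1) - S x = ∫ t in x..x + 1, (1 - η t) :=
      intervalIntegral.integral_interval_sub_left (hc1.intervalIntegrable _ _)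
        (hc1.intervalIntegrable _ _)
    have hp1 : Function.Periodic (fun t => 1 - η t) 1 := fun x => by
      show 1 - η (x + 1) = 1 - η x
      rw [hηp x]
    rw [hp1.intervalIntegral_add_eq x 0, zero_add, intervalIntegral.integral_sub (by simp)
      (hηc.intervalIntegrable _ _)] at h1
    simp only [η, intervalIntegral.integral_div, ← hmdef, div_self hm.ne'] at h1
    simp at h1
    linarith
  obtain ⟨C1, hC1⟩ := (hηp.isBounded_of_continuous one_ne_zero hηc).exists_norm_le
  obtain ⟨C2, hC2⟩ := (hSp.isBounded_of_continuous one_ne_zero hSc).exists_norm_le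
  refine ⟨η, S, max 1 (max C1 C2), le_max_left _ _, hηc, fun x => ?_, fun x => ?_, hSd,
    fun x hx => ?_⟩
  · exact (hC1 _ ⟨x, rfl⟩).trans ((le_max_left _ _).trans (le_max_right _ _))
  · exact (hC2 _ ⟨x, rfl⟩).trans ((le_max_right _ _).trans (le_max_right _ _))
  · by_contra! hlt
    refine hx ?_
    have h1 : Real.cos (2 * Real.pi * x) = Real.cos (2 * Real.pi * |x - round x|) := by
      have : 2 * Real.pi * |x - round x| = |2 * Real.pi * x - round x * (2 * Real.pi)| := by
        rw [← abs_of_pos Real.two_pi_pos, ← abs_mul, abs_of_pos Real.two_pi_pos]; ring_nf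
      rw [this, Real.cos_abs, Real.cos_sub_int_mul_two_pi]
    have h2 : Real.cos (2 * Real.pi * |x - round x|) ≤ q := by
      refine Real.cos_le_cos_of_nonneg_of_le_pi (by have := Real.pi_pos; positivity) ?_ ?_
      · nlinarith [Real.pi_pos, abs_sub_round x]
      · have := Real.pi_pos; gcongr
    have : b x = 0 := by simp only [b]; exact max_eq_left (by linarith)
    simp [η, this]

end Periodic

/-! ### Integration by parts, Poincaré and Cauchy–Schwarz. -/

section Parts

variable {d : ℕ} {U : Set (EuclideanSpace ℝ (Fin d))} {φ : EuclideanSpace ℝ (Fin d) → ℝ}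

lemma IsTest.integral_mul_fderiv (hφ : IsTest U φ) {f f' : EuclideanSpace ℝ (Fin d) → ℝ}
    (hf : Continuous f) (hf' : Continuous f') (v : EuclideanSpace ℝ (Fin d))
    (h : ∀ x, HasLineDerivAt ℝ f (f' x) x v) :
    ∫ x, f x * fderiv ℝ φ x v = - ∫ x, f' x * φ x := by
  have hc : Continuous fun x => fderiv ℝ φ x v :=
    (hφ.1.continuous_fderiv (by simp)).clm_apply continuous_const
  have hs : HasCompactSupport fun x => fderiv ℝ φ x v :=
    (hφ.2.1.fderiv ℝ).comp_left (g := fun L : EuclideanSpace ℝ (Fin d) →L[ℝ] ℝ => L v) rfl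
  have := integral_bilinear_hasLineDerivAt_right_eq_neg_left_of_integrable
    (μ := (volume : Measure (EuclideanSpace ℝ (Fin d))))
    (B := ContinuousLinearMap.mul ℝ ℝ) (f := f) (f' := f') (g := φ)
    (g' := fun x => fderiv ℝ φ x v) (v := v)
    ((hf'.mul hφ.1.continuous).integrable_of_hasCompactSupport hφ.2.1.mul_left)
    ((hf.mul hc).integrable_of_hasCompactSupport hs.mul_left)
    ((hf.mul hφ.1.continuous).integrable_of_hasCompactSupport hφ.2.1.mul_left)
    (fun x _ => h x) (fun x _ => (hφ.differentiable x).hasFDerivAt.hasLineDerivAt v)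
  simpa using this

lemma IsTest.sq (hφ : IsTest U φ) : IsTest U (fun x => φ x ^ 2) := by
  refine ⟨hφ.1.pow 2, hφ.2.1.comp_left (g := fun t : ℝ => t ^ 2) (by simp), ?_⟩
  refine (closure_mono fun x hx => ?_).trans hφ.2.2
  simp only [Function.mem_support] at hx ⊢
  contrapose! hx
  simp [hx]

lemma abs_fderiv_single_le (φ : EuclideanSpace ℝ (Fin d) → ℝ) (x : EuclideanSpace ℝ (Fin d))
    (i : Fin d) : |fderiv ℝ φ x (EuclideanSpace.single i 1)| ≤ ‖∇ φ x‖ := by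
  rw [norm_gradient]
  simpa using (fderiv ℝ φ x).le_opNorm (EuclideanSpace.single i 1)

/-- Poincaré's inequality in a slab. -/
lemma IsTest.poincare_slab (hφ : IsTest U φ) (i : Fin d) (hU : ∀ x ∈ U, x i ∈ Ioo (0 : ℝ) 1) :
    ∫ x, φ x ^ 2 ≤ 4 * ∫ x, ‖∇ φ x‖ ^ 2 := by
  -- Integrating `φ²` against `∂_i x_i = 1` gives `∫ φ² = -2 ∫ x_i φ ∂_iφ`. Young's inequality with
  -- `|x_i| ≤ 1` bounds this by `½ ∫ φ² + 2 ∫ |∇φ|²`; absorbing the first term yields the constant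
  -- `4`.
  have h1 := hφ.sq.integral_mul_fderiv (f := fun x => x i) (f' := fun _ => 1) (by fun_prop)
    (by fun_prop) (EuclideanSpace.single i 1) fun x => by
      have := (EuclideanSpace.proj i : EuclideanSpace ℝ (Fin d) →L[ℝ] ℝ).hasFDerivAt
        (x := x) |>.hasLineDerivAt (EuclideanSpace.single i 1)
      simpa using this
  have hd : ∀ x, fderiv ℝ (fun x => φ x ^ 2) x (EuclideanSpace.single i 1)
      = 2 * φ x * fderiv ℝ φ x (EuclideanSpace.single i 1) := fun x => by
    rw [fderiv_fun_pow 2 (hφ.differentiable x)]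
    simp
  simp only [one_mul, hd] at h1
  have h2 : ∫ x, -(x i * (2 * φ x * fderiv ℝ φ x (EuclideanSpace.single i 1))) ≤
      ∫ x, ((1 / 2) * φ x ^ 2 + 2 * ‖∇ φ x‖ ^ 2) := by
    have hc : Continuous fun x => fderiv ℝ φ x (EuclideanSpace.single i 1) :=
      (hφ.1.continuous_fderiv (by simp)).clm_apply continuous_const
    have hφc := hφ.1.continuous
    have hint : Integrable fun x : EuclideanSpace ℝ (Fin d) =>
        x i * (2 * φ x * fderiv ℝ φ x (EuclideanSpace.single i 1)) :=
      Continuous.integrable_of_hasCompactSupport (by fun_prop)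
        (HasCompactSupport.mul_left (HasCompactSupport.mul_right hφ.2.1.mul_left))
    refine integral_mono hint.neg ((hφ.memLp.integrable_sq.const_mul _).add
      (hφ.integrable_sq_gradient.const_mul _)) fun x => ?_
    by_cases hx : x ∈ U
    · have hb := abs_fderiv_single_le φ x i
      set t := fderiv ℝ φ x (EuclideanSpace.single i 1)
      obtain ⟨h0, h1⟩ := hU x hx
      have ht : t ^ 2 ≤ ‖∇ φ x‖ ^ 2 := sq_le_sq.2 (by rwa [abs_of_nonneg (norm_nonneg (∇ φ x))])
      have hx2 : x i ^ 2 ≤ 1 := by nlinarith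
      have hxt : x i ^ 2 * t ^ 2 ≤ 1 * t ^ 2 := by gcongr
      simp only
      nlinarith [sq_nonneg (φ x + 2 * (x i * t))]
    · simp only [hφ.eq_zero hx]
      simp
  rw [integral_neg, h1, integral_add (hφ.memLp.integrable_sq.const_mul _)
    (hφ.integrable_sq_gradient.const_mul _), integral_const_mul, integral_const_mul] at h2
  linarith

lemma sq_setIntegral_le {X : Type*} [MeasurableSpace X] {μ : Measure X} {R : Set X}
    (hR : μ R ≠ ⊤) {u : X → ℝ} (hu : IntegrableOn u R μ) (hu2 : IntegrableOn (fun x => u x ^ 2) R μ) :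
    (∫ x in R, u x ∂μ) ^ 2 ≤ μ.real R * ∫ x in R, u x ^ 2 ∂μ := by
  have : IsFiniteMeasure (μ.restrict R) := isFiniteMeasure_restrict.2 hR
  -- The polynomial is `∫_R (t - u)²`; its discriminant is nonpositive.
  have key : ∀ t : ℝ, 0 ≤ μ.real R * (t * t) + (-2 * ∫ x in R, u x ∂μ) * t + ∫ x in R, u x ^ 2 ∂μ := by
    intro t
    have h0 : 0 ≤ ∫ x in R, (t - u x) ^ 2 ∂μ := integral_nonneg fun x => sq_nonneg _
    have h1 : ∀ x, (t - u x) ^ 2 = (t * t + (-2 * t) * u x) + u x ^ 2 := fun x => by ring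
    simp only [h1] at h0
    have hi : Integrable (fun x => t * t + -2 * t * u x) (μ.restrict R) :=
      (integrable_const _).add (hu.const_mul _)
    rw [integral_add hi hu2, integral_add (integrable_const _) (hu.const_mul _), integral_const_mul (-2 * t), integral_const,
      measureReal_restrict_apply_univ, smul_eq_mul] at h0
    linarith
  have := discrim_le_zero key
  rw [discrim] at this
  nlinarith

lemma IsTest.sq_integral_norm_gradient_le (hφ : IsTest U φ) {R : Set (EuclideanSpace ℝ (Fin d))}
    (hUR : U ⊆ R) (hR : volume R ≠ ⊤) :
    (∫ x, ‖∇ φ x‖) ^ 2 ≤ volume.real R * ∫ x, ‖∇ φ x‖ ^ 2 := by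
  have h0 : ∀ x ∉ R, ∇ φ x = 0 := fun x hx => hφ.gradient_eq_zero fun h => hx (hUR h)
  rw [← setIntegral_eq_integral_of_forall_compl_eq_zero (s := R) (fun x hx => by simp [h0 x hx]),
    ← setIntegral_eq_integral_of_forall_compl_eq_zero (s := R) (f := fun x => ‖∇ φ x‖ ^ 2)
      (fun x hx => by simp [h0 x hx])]
  exact sq_setIntegral_le hR
    (hφ.continuous_gradient.norm.integrable_of_hasCompactSupport
      hφ.hasCompactSupport_gradient.norm).integrableOn hφ.integrable_sq_gradient.integrableOn

end Parts

/-! ### Torsion estimate away from a lattice. -/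

section Lattice

variable {d : ℕ}

/-- If the test functions vanish near the points of the lattice `K⁻¹ ℤ^d`, then the torsional
rigidity is of order `K⁻²`. -/
lemma exists_torsionBound_lattice (d : ℕ) {τ : ℝ} (hτ : 0 < τ) :
    ∃ C : ℝ, 0 < C ∧ ∀ K : ℝ, 0 < K → ∀ R U : Set (EuclideanSpace ℝ (Fin d)), volume R ≠ ⊤ → U ⊆ R → (∀ x ∈ U, ∃ i, τ < |K * x i - round (K * x i)|) →
      TorsionBound U (C * volume.real R / K ^ 2) := by
  obtain ⟨η, S, C, hC, hηc, hη, hS, hSd, hη0⟩ := exists_periodic_bump hτ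
  have hSc : Continuous S := continuous_iff_continuousAt.2 fun x => (hSd x).continuousAt
  refine ⟨(d * C ^ (d + 1)) ^ 2 + 1, by positivity, fun K hK R U hR hUR hU φ hφ => ?_⟩
  -- The telescoping identity `1 - ∏ η_i = ∑ P_i (1 - η_i)`, with `η_i = η(K x_i)`, drives the
  -- proof. On `U` the product vanishes, and since `P_i` does not depend on `x_i`, each summand is
  -- the `i`-th derivative of `P_i S(K x_i) / K`, of size `O(1/K)`. Integration by parts then gives
  -- `|∫ φ| ≤ (C'/K) ∫ |∇φ|`.
  set P : Fin d → EuclideanSpace ℝ (Fin d) → ℝ :=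
    fun i x => ∏ j with j < i, η (K * x j) with hP
  have hPc : ∀ i, Continuous (P i) := fun i => by simp only [hP]; fun_prop
  have hPb : ∀ i x, |P i x| ≤ C ^ d := fun i x => by
    simp only [hP, Finset.abs_prod]
    calc _ ≤ ∏ j : Fin d with j < i, C := Finset.prod_le_prod (fun _ _ => abs_nonneg _)
            fun j _ => hη _
      _ = C ^ (Finset.univ.filter fun j : Fin d => j < i).card := by simp
      _ ≤ C ^ d := by
          refine pow_le_pow_right₀ hC ?_
          simpa using Finset.card_filter_le (Finset.univ : Finset (Fin d)) (fun j => j < i)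
  have hparts : ∀ i, ∫ x, (P i x * (1 - η (K * x i))) * φ x =
      - ∫ x, (P i x * (S (K * x i) / K)) * fderiv ℝ φ x (EuclideanSpace.single i 1) := by
    intro i
    have hPi := hPc i
    rw [hφ.integral_mul_fderiv (f' := fun x => P i x * (1 - η (K * x i))) (by fun_prop)
      (by fun_prop), neg_neg]
    intro x
    have hx : ∀ t : ℝ, P i (x + t • EuclideanSpace.single i 1) = P i x := by
      intro t
      refine Finset.prod_congr rfl fun j hj => ?_
      have : j ≠ i := (Finset.mem_filter.1 hj).2.ne
      simp [this]
    have hd : HasDerivAt (fun t : ℝ => P i x * (S (K * (x i + t)) / K))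
        (P i x * (1 - η (K * x i))) 0 := by
      have h1 : HasDerivAt (fun t : ℝ => K * (x i + t)) K 0 := by
        simpa using ((hasDerivAt_id (0 : ℝ)).const_add (x i)).const_mul K
      have h2 := (((hSd (K * (x i + 0))).comp (0 : ℝ) h1).div_const K).const_mul (P i x)
      have h3 : (1 - η (K * (x i + 0))) * K / K = 1 - η (K * x i) := by
        rw [add_zero]; field_simp
      rw [h3] at h2
      exact h2
    refine HasDerivAt.congr_of_eventuallyEq hd (Eventually.of_forall fun t => ?_)
    simp only [hx]
    simp
  have hsum : ∀ x, ∑ i, (P i x * (1 - η (K * x i))) * φ x = φ x := by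
    intro x
    have h1 := Finset.prod_one_sub_ordered Finset.univ fun i : Fin d => 1 - η (K * x i)
    simp only [sub_sub_cancel] at h1
    rw [← Finset.sum_mul]
    by_cases hx : x ∈ U
    · obtain ⟨i, hi⟩ := hU x hx
      have h2 : η (K * x i) = 0 := by
        by_contra h
        exact absurd (hη0 _ h) (not_le.2 hi)
      rw [Finset.prod_eq_zero (Finset.mem_univ i) h2] at h1
      have : ∑ i, P i x * (1 - η (K * x i)) = 1 := by
        rw [eq_comm, sub_eq_zero] at h1
        refine Eq.trans ?_ h1.symm
        exact Finset.sum_congr rfl fun i _ => mul_comm _ _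
      rw [this, one_mul]
    · simp [hφ.eq_zero hx]
  have hint : ∫ x, φ x = ∑ i, ∫ x, (P i x * (1 - η (K * x i))) * φ x := by
    rw [← integral_finsetSum]
    · exact integral_congr_ae (Eventually.of_forall fun x => (hsum x).symm)
    · intro i _
      have hPi := hPc i
      exact Continuous.integrable_of_hasCompactSupport
        (Continuous.mul (by fun_prop) hφ.1.continuous) hφ.2.1.mul_left
  have hbound : |∫ x, φ x| ≤ (d * C ^ (d + 1)) / K * ∫ x, ‖∇ φ x‖ := by
    rw [hint]
    refine (Finset.abs_sum_le_sum_abs _ _).trans ?_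
    have : ∀ i ∈ (Finset.univ : Finset (Fin d)), |∫ x, (P i x * (1 - η (K * x i))) * φ x| ≤
        C ^ (d + 1) / K * ∫ x, ‖∇ φ x‖ := by
      intro i _
      rw [hparts, abs_neg, ← integral_const_mul, ← Real.norm_eq_abs]
      refine norm_integral_le_of_norm_le
        ((hφ.continuous_gradient.norm.integrable_of_hasCompactSupport
          hφ.hasCompactSupport_gradient.norm).const_mul _) (Eventually.of_forall fun x => ?_)
      rw [Real.norm_eq_abs, abs_mul, abs_mul, abs_div, abs_of_pos hK, pow_succ, mul_div_assoc]
      gcongr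
      · exact hPb i x
      · exact hS _
      · exact abs_fderiv_single_le φ x i
    refine (Finset.sum_le_sum this).trans (le_of_eq ?_)
    simp; ring
  have h0 : 0 ≤ ∫ x, ‖∇ φ x‖ := integral_nonneg fun _ => norm_nonneg _
  have h2 : 0 ≤ ∫ x, ‖∇ φ x‖ ^ 2 := integral_nonneg fun _ => by positivity
  calc (∫ x, φ x) ^ 2 = |∫ x, φ x| ^ 2 := (sq_abs _).symm
    _ ≤ ((d * C ^ (d + 1)) / K * ∫ x, ‖∇ φ x‖) ^ 2 := by gcongr
    _ = (d * C ^ (d + 1)) ^ 2 / K ^ 2 * (∫ x, ‖∇ φ x‖) ^ 2 := by ring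
    _ ≤ (d * C ^ (d + 1)) ^ 2 / K ^ 2 * (volume.real R * ∫ x, ‖∇ φ x‖ ^ 2) := by
        gcongr
        exact hφ.sq_integral_norm_gradient_le hUR hR
    _ = (d * C ^ (d + 1)) ^ 2 * volume.real R / K ^ 2 * ∫ x, ‖∇ φ x‖ ^ 2 := by ring
    _ ≤ _ := by
        gcongr
        linarith

end Lattice

/-! ### Gluing and scaling of torsion bounds. -/

section Glue

variable {d : ℕ} {U Q V : Set (EuclideanSpace ℝ (Fin d))} {φ : EuclideanSpace ℝ (Fin d) → ℝ}

/-- The support of `φ` lies in a disjoint union of two open sets, so cutting at `Q` creates no jump.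
-/
lemma IsTest.indicator (hφ : IsTest U φ) (hQ : IsOpen Q) (hV : IsOpen V) (hQV : Disjoint Q V)
    (hU : U ⊆ Q ∪ V) : IsTest (U ∩ Q) (Q.indicator φ) := by
  have hsub : tsupport (Q.indicator φ) ⊆ tsupport φ := by
    refine closure_mono fun x hx => ?_
    rw [Set.support_indicator] at hx
    exact hx.2
  have hsub' : tsupport (Q.indicator φ) ⊆ Vᶜ := by
    refine closure_minimal (fun x hx => ?_) hV.isClosed_compl
    rw [Set.support_indicator] at hx
    exact fun h => Set.disjoint_left.1 hQV hx.1 h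
  refine ⟨contDiff_iff_contDiffAt.2 fun x => ?_,
    hφ.2.1.of_isClosed_subset (isClosed_tsupport _) hsub, fun x hx => ?_⟩
  · by_cases hx : x ∈ Q
    · refine hφ.1.contDiffAt.congr_of_eventuallyEq ?_
      filter_upwards [hQ.mem_nhds hx] with y hy
      rw [indicator_of_mem hy]
    · have hx' : x ∉ tsupport (Q.indicator φ) := fun h =>
        (hU (hφ.2.2 (hsub h))).elim hx fun hv => hsub' h hv
      exact contDiffAt_const.congr_of_eventuallyEq (notMem_tsupport_iff_eventuallyEq.1 hx')
  · exact ⟨hφ.2.2 (hsub hx), (hU (hφ.2.2 (hsub hx))).resolve_right (hsub' hx)⟩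

lemma IsTest.gradient_indicator (hφ : IsTest U φ) (hQ : IsOpen Q) (hV : IsOpen V)
    (hQV : Disjoint Q V) (hU : U ⊆ Q ∪ V) : ∇ (Q.indicator φ) = Q.indicator (∇ φ) := by
  ext1 x
  by_cases hx : x ∈ Q
  · rw [indicator_of_mem hx]
    refine Filter.EventuallyEq.gradient_eq ?_
    filter_upwards [hQ.mem_nhds hx] with y hy
    rw [indicator_of_mem hy]
  · rw [indicator_of_notMem hx, (hφ.indicator hQ hV hQV hU).gradient_eq_zero fun h => hx h.2]

/-- Test functions on `U ⊆ Q ∪ V` split, so that the torsional rigidities add up. -/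
lemma TorsionBound.glue {M N : ℝ} (hM : 0 ≤ M) (hN : 0 ≤ N) (h1 : TorsionBound (U ∩ Q) M)
    (h2 : TorsionBound (U ∩ V) N) (hQ : IsOpen Q) (hV : IsOpen V) (hQV : Disjoint Q V)
    (hU : U ⊆ Q ∪ V) : TorsionBound U (M + N) := by
  intro φ hφ
  have t1 := hφ.indicator hQ hV hQV hU
  have t2 := hφ.indicator hV hQ hQV.symm (hU.trans (union_comm Q V).subset)
  have e1 := h1 _ t1
  have e2 := h2 _ t2
  have hi : ∫ x, φ x = (∫ x, Q.indicator φ x) + ∫ x, V.indicator φ x := by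
    rw [← integral_add t1.integrable t2.integrable]
    congr 1 with x
    by_cases hx : x ∈ U
    · rcases hU hx with h | h
      · simp [h, Set.disjoint_left.1 hQV h]
      · simp [h, Set.disjoint_right.1 hQV h]
    · rw [hφ.eq_zero hx, t1.eq_zero fun h => hx h.1, t2.eq_zero fun h => hx h.1, add_zero]
  have hg : ∫ x, ‖∇ φ x‖ ^ 2 =
      (∫ x, ‖∇ (Q.indicator φ) x‖ ^ 2) + ∫ x, ‖∇ (V.indicator φ) x‖ ^ 2 := by
    rw [← integral_add t1.integrable_sq_gradient t2.integrable_sq_gradient]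
    rw [hφ.gradient_indicator hQ hV hQV hU,
      hφ.gradient_indicator hV hQ hQV.symm (hU.trans (union_comm Q V).subset)]
    congr 1 with x
    by_cases hx : x ∈ U
    · rcases hU hx with h | h
      · simp [h, Set.disjoint_left.1 hQV h]
      · simp [h, Set.disjoint_right.1 hQV h]
    · have h0 := hφ.gradient_eq_zero hx
      rw [indicator_apply_eq_zero.2 fun _ => h0, indicator_apply_eq_zero.2 fun _ => h0, h0]
      simp
  rw [hi, hg]
  have hX : 0 ≤ ∫ x, ‖∇ (Q.indicator φ) x‖ ^ 2 := integral_nonneg fun _ => by positivity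
  have hY : 0 ≤ ∫ x, ‖∇ (V.indicator φ) x‖ ^ 2 := integral_nonneg fun _ => by positivity
  generalize (∫ x, ‖∇ (Q.indicator φ) x‖ ^ 2) = X at *
  generalize (∫ x, ‖∇ (V.indicator φ) x‖ ^ 2) = Y at *
  generalize (∫ x, Q.indicator φ x) = A at *
  generalize (∫ x, V.indicator φ x) = B at *
  -- This controls the cross term of `(A + B)²` by the mixed terms of `(M + N)(X + Y)`.
  have h3 : (2 * (A * B)) ^ 2 ≤ (M * Y + N * X) ^ 2 := by
    have : A ^ 2 * B ^ 2 ≤ (M * X) * (N * Y) := by gcongr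
    nlinarith [sq_nonneg (M * Y - N * X)]
  have h4 := (abs_le_of_sq_le_sq' h3 (by positivity)).2
  nlinarith

-- The rescaled constant is `s^(d+2) M`; the factor is at most one and is dropped.
open scoped Pointwise in
lemma TorsionBound.smul {M s : ℝ} (hM : 0 ≤ M) (h : TorsionBound U M) (hs : 0 < s) (hs1 : s ≤ 1) :
    TorsionBound (s • U) M := by
  intro φ hφ
  set ψ : EuclideanSpace ℝ (Fin d) → ℝ := fun y => φ (s • y) with hψ
  have ht : IsTest U ψ := by
    refine ⟨hφ.1.comp (contDiff_const_smul s),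
      hφ.2.1.comp_homeomorph (Homeomorph.smulOfNeZero s hs.ne'), ?_⟩
    have : tsupport ψ = (s • ·) ⁻¹' tsupport φ :=
      tsupport_comp_eq_preimage φ (Homeomorph.smulOfNeZero s hs.ne')
    rw [this]
    intro y hy
    exact (Set.smul_mem_smul_set_iff₀ hs.ne' _ _).1 (hφ.2.2 hy)
  have h1 := h ψ ht
  have hg : ∀ y, ‖∇ ψ y‖ ^ 2 = s ^ 2 * ‖∇ φ (s • y)‖ ^ 2 := fun y => by
    rw [norm_gradient, norm_gradient, hψ, fderiv_comp_smul, norm_smul, mul_pow,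
      Real.norm_eq_abs, sq_abs]
  simp only [hg] at h1
  simp only [hψ] at h1
  rw [integral_const_mul, Measure.integral_comp_smul,
    Measure.integral_comp_smul volume (fun y => ‖∇ φ y‖ ^ 2)] at h1
  have hX : 0 ≤ ∫ x, ‖∇ φ x‖ ^ 2 := integral_nonneg fun _ => by positivity
  simp only [finrank_euclideanSpace_fin, smul_eq_mul] at h1
  rw [abs_of_pos (by positivity)] at h1
  generalize (∫ x, ‖∇ φ x‖ ^ 2) = X at *
  generalize (∫ x, φ x) = A at *
  have hsd : 0 < s ^ d := by positivity
  have h2 : A ^ 2 ≤ M * X * s ^ (d + 2) := by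
    have : A ^ 2 = ((s ^ d)⁻¹ * A) ^ 2 * (s ^ d) ^ 2 := by field_simp
    rw [this]
    calc _ ≤ (M * (s ^ 2 * ((s ^ d)⁻¹ * X))) * (s ^ d) ^ 2 := by gcongr
      _ = M * X * s ^ (d + 2) := by field_simp; ring
  refine h2.trans (mul_le_of_le_one_right (by positivity) (pow_le_one₀ hs.le hs1))

end Glue

/-! ### The unit cube and its shrunken copies. -/

section Cube

variable {d : ℕ}

/-- The cube `(0,s)^d`. -/
def cube (d : ℕ) (s : ℝ) : Set (EuclideanSpace ℝ (Fin d)) := {x | ∀ i, x i ∈ Ioo (0 : ℝ) s}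

lemma isOpen_cube (s : ℝ) : IsOpen (cube d s) := by
  simp only [cube, ofPred_forall]
  exact isOpen_iInter_of_finite fun i => isOpen_Ioo.preimage (by fun_prop)

lemma isOpen_unitCube : IsOpen (unitCube d) := isOpen_cube 1

lemma isBounded_unitCube : Bornology.IsBounded (unitCube d) := by
  refine (Metric.isBounded_closedBall (x := 0) (r := Real.sqrt d)).subset fun x hx => ?_
  rw [mem_closedBall_zero_iff, EuclideanSpace.norm_eq]
  refine Real.sqrt_le_sqrt ?_
  calc ∑ i, ‖x i‖ ^ 2 ≤ ∑ _i : Fin d, (1 : ℝ) := by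
        refine Finset.sum_le_sum fun i _ => ?_
        have := hx i
        rw [Real.norm_eq_abs, abs_of_pos this.1]
        nlinarith [this.1, this.2]
    _ = d := by simp

lemma volume_unitCube_ne_top : volume (unitCube d) ≠ ⊤ := isBounded_unitCube.measure_lt_top.ne

instance : IsFiniteMeasure (volume.restrict (unitCube d)) :=
  isFiniteMeasure_restrict.2 volume_unitCube_ne_top

lemma unitCube_nonempty : (unitCube d).Nonempty :=
  ⟨WithLp.toLp 2 fun _ => 1 / 2, fun i => by simp; norm_num⟩

open scoped Pointwise in
lemma smul_unitCube {s : ℝ} (hs : 0 < s) : s • unitCube d = cube d s := by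
  ext x
  rw [Set.mem_smul_set_iff_inv_smul_mem₀ hs.ne']
  simp only [unitCube, cube, mem_ofPred_eq, PiLp.smul_apply, smul_eq_mul, mem_Ioo]
  refine forall_congr' fun i => ?_
  rw [inv_mul_lt_iff₀ hs, mul_one]
  simp [hs]

lemma volume_real_unitCube_diff_cube {s : ℝ} (hs : 0 < s) (hs1 : s ≤ 1) :
    volume.real (unitCube d \ cube d s) = (1 - s ^ d) * volume.real (unitCube d) := by
  have hsub : cube d s ⊆ unitCube d := fun x hx i => ⟨(hx i).1, (hx i).2.trans_le hs1⟩
  rw [measureReal_sdiff hsub (isOpen_cube s).measurableSet (isBounded_unitCube.measure_lt_top.ne),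
    ← smul_unitCube hs, measureReal_def, measureReal_def, Measure.addHaar_smul]
  simp [abs_of_pos hs, ENNReal.toReal_ofReal (pow_nonneg hs.le d)]
  ring

lemma torsionBound_compliance_unitCube (hd : 1 ≤ d) (S : Set (EuclideanSpace ℝ (Fin d))) :
    TorsionBound (unitCube d \ S) (compliance S (fun _ => 1) (unitCube d)) :=
  torsionBound_compliance isOpen_unitCube.measurableSet (C := 4) (by norm_num) fun _ hφ =>
    hφ.poincare_slab ⟨0, hd⟩ fun _ hx => hx.1 _

lemma compliance_unitCube_le {S : Set (EuclideanSpace ℝ (Fin d))} {M : ℝ} (hM : 0 ≤ M)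
    (h : TorsionBound (unitCube d \ S) M) : compliance S (fun _ => 1) (unitCube d) ≤ M :=
  compliance_le_of_torsionBound isOpen_unitCube.measurableSet hM h

end Cube

/-! ### Finite grids of ball centres. -/

section Grid

variable {d : ℕ}

/-- The point `k / K` of the grid of mesh `1 / K`. -/
def gridPoint {K : ℕ} (k : Fin d → Fin (K + 1)) : EuclideanSpace ℝ (Fin d) :=
  WithLp.toLp 2 fun i => (k i : ℝ) / K

lemma dist_gridPoint_le {K : ℕ} (hK : 0 < K) {τ : ℝ} (k : Fin d → Fin (K + 1))
    {x : EuclideanSpace ℝ (Fin d)} (h : ∀ i, |K * x i - k i| ≤ τ) :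
    dist x (gridPoint k) ≤ Real.sqrt d * τ / K := by
  have hK' : (0 : ℝ) < K := by exact_mod_cast hK
  rcases Nat.eq_zero_or_pos d with rfl | hd
  · simp [EuclideanSpace.dist_eq]
  have hτ : 0 ≤ τ := (abs_nonneg _).trans (h ⟨0, hd⟩)
  rw [EuclideanSpace.dist_eq]
  refine Real.sqrt_le_iff.2 ⟨by positivity, ?_⟩
  rw [div_pow, mul_pow, Real.sq_sqrt (by positivity)]
  calc ∑ i, dist (x i) (gridPoint k i) ^ 2 ≤ ∑ _i : Fin d, (τ / K) ^ 2 := by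
        refine Finset.sum_le_sum fun i _ => ?_
        gcongr
        rw [Real.dist_eq, le_div_iff₀ hK']
        refine le_of_eq_of_le ?_ (h i)
        rw [← abs_of_pos hK', ← abs_mul, abs_of_pos hK']
        congr 1
        simp only [gridPoint]
        field_simp
    _ = d * τ ^ 2 / K ^ 2 := by simp; ring

/-- Grid points may lie on the boundary of the cube, so they are moved slightly towards its centre.
-/
lemma gridPoint_mem_thickening {K : ℕ} (hK : 0 < K) (k : Fin d → Fin (K + 1)) {r : ℝ}
    (hr : 0 < r) : gridPoint k ∈ Metric.thickening r (unitCube d) := by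
  have hK' : (0 : ℝ) < K := by exact_mod_cast hK
  set c : EuclideanSpace ℝ (Fin d) := WithLp.toLp 2 fun _ => 1 / 2
  have hcont : ContinuousAt (fun t : ℝ => gridPoint k + t • (c - gridPoint k)) 0 := by fun_prop
  have hev : ∀ᶠ t in 𝓝[>] (0 : ℝ), dist (gridPoint k) (gridPoint k + t • (c - gridPoint k)) < r := by
    refine nhdsWithin_le_nhds ?_
    have := hcont.eventually (Metric.ball_mem_nhds _ hr)
    filter_upwards [this] with t ht
    simpa [dist_comm] using ht
  obtain ⟨t, ht, ht0, ht1⟩ := (hev.and (Ioo_mem_nhdsGT one_pos)).exists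
  refine Metric.mem_thickening_iff.2 ⟨_, fun i => ?_, ht⟩
  have h0 : 0 ≤ (k i : ℝ) / K := by positivity
  have h1 : (k i : ℝ) / K ≤ 1 := by
    rw [div_le_one hK']
    exact_mod_cast Nat.lt_succ_iff.1 (k i).2
  simp only [gridPoint, c, PiLp.add_apply, PiLp.smul_apply, PiLp.sub_apply, smul_eq_mul, mem_Ioo]
  constructor <;> nlinarith

/-- The grid points with some index satisfying `P`. -/
def gridSlab (d K : ℕ) (P : Fin (K + 1) → Prop) : Finset (EuclideanSpace ℝ (Fin d)) := by
  classical exact (Finset.univ.filter fun k : Fin d → Fin (K + 1) => ∃ i, P (k i)).image gridPoint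

lemma mem_gridSlab {K : ℕ} {P : Fin (K + 1) → Prop} {x : EuclideanSpace ℝ (Fin d)} :
    x ∈ gridSlab d K P ↔ ∃ k : Fin d → Fin (K + 1), (∃ i, P (k i)) ∧ gridPoint k = x := by
  simp [gridSlab]

open Classical in
-- Union bound over the coordinate that satisfies `P`; even for a full grid it keeps a spare factor
-- `d`.
lemma card_gridSlab_le (d K : ℕ) (P : Fin (K + 1) → Prop) :
    (gridSlab d K P).card ≤ d * ((Finset.univ.filter P).card * (K + 1) ^ (d - 1)) := by
  rw [gridSlab]
  refine Finset.card_image_le.trans ?_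
  have hsub : (Finset.univ.filter fun k : Fin d → Fin (K + 1) => ∃ i, P (k i)) ⊆
      Finset.univ.biUnion fun i => Fintype.piFinset
        fun j => if j = i then Finset.univ.filter P else Finset.univ := by
    intro k hk
    obtain ⟨i, hi⟩ := (Finset.mem_filter.1 hk).2
    refine Finset.mem_biUnion.2 ⟨i, Finset.mem_univ i, Fintype.mem_piFinset.2 fun j => ?_⟩
    by_cases h : j = i
    · subst h; simpa using hi
    · simp [h]
  refine (Finset.card_le_card hsub).trans (Finset.card_biUnion_le.trans ?_)
  refine (Finset.sum_le_card_nsmul _ _ ((Finset.univ.filter P).card * (K + 1) ^ (d - 1))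
    fun i _ => ?_).trans (by simp)
  rw [Fintype.card_piFinset]
  simp only [apply_ite Finset.card, Finset.card_univ, Fintype.card_fin]
  rw [← Finset.mul_prod_erase _ _ (Finset.mem_univ i), if_pos rfl,
    Finset.prod_congr rfl (g := fun _ => K + 1) fun j hj => if_neg (Finset.ne_of_mem_erase hj)]
  simp

/-- The trace on the closed cube of a finite union of balls. -/
def ballTrace (r : ℝ) (T : Finset (EuclideanSpace ℝ (Fin d))) : Set (EuclideanSpace ℝ (Fin d)) :=
  closure (unitCube d) ∩ ⋃ p ∈ T, Metric.closedBall p r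

lemma mem_ballTrace {r : ℝ} {T : Finset (EuclideanSpace ℝ (Fin d))} {x : EuclideanSpace ℝ (Fin d)}
    (hx : x ∈ unitCube d) {p : EuclideanSpace ℝ (Fin d)} (hp : p ∈ T) (h : dist x p ≤ r) :
    x ∈ ballTrace r T :=
  ⟨subset_closure hx, mem_biUnion hp h⟩

/-- Admissible sets allow repeated centres, so fewer than `N` distinct ones suffice, provided there
is at least one to repeat. -/
lemma ballTrace_mem_admissible {a r : ℝ} {N : ℕ} (hr : r = a * (N : ℝ) ^ (-(1 / (d : ℝ))))
    {T : Finset (EuclideanSpace ℝ (Fin d))} (hT : T.Nonempty) (hcard : T.card ≤ N)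
    (hmem : ∀ p ∈ T, p ∈ Metric.thickening r (unitCube d)) :
    ballTrace r T ∈ admissible a N (unitCube d) := by
  obtain ⟨e⟩ : Nonempty (T ↪ Fin N) := by
    rw [Function.Embedding.nonempty_iff_card_le]; simpa using hcard
  have : Nonempty T := hT.to_subtype
  set x : Fin N → T := Function.invFun e
  have hx : Function.Surjective x := Function.invFun_surjective e.injective
  refine ⟨fun i => x i, fun i => hr ▸ hmem _ (x i).2, ?_⟩
  rw [ballTrace, ← hr]
  congr 1
  rw [hx.iUnion_comp (fun p : T => Metric.closedBall (p : EuclideanSpace ℝ (Fin d)) r),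
    iUnion_subtype]

lemma card_filter_le_index (K : ℕ) {t : ℝ} (ht : t ≤ K) :
    ((Finset.univ.filter fun j : Fin (K + 1) => t ≤ (j : ℝ)).card : ℝ) ≤ K - t + 1 := by
  have h1 : (Finset.univ.filter fun j : Fin (K + 1) => t ≤ (j : ℝ)).card ≤ ⌊(K : ℝ) - t⌋₊ + 1 := by
    rw [← Finset.card_range (⌊(K : ℝ) - t⌋₊ + 1)]
    refine Finset.card_le_card_of_injOn (fun j => K - j) (fun j hj => ?_) fun i _ j _ hij => ?_
    · have hj' : t ≤ (j : ℝ) := (Finset.mem_filter.1 hj).2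
      have hjK : (j : ℕ) ≤ K := Nat.lt_succ_iff.1 j.2
      simp only [Finset.coe_range, mem_Iio, Nat.lt_succ_iff]
      refine Nat.le_floor ?_
      rw [Nat.cast_sub hjK]
      linarith
    · have := i.2; have := j.2
      simp only at hij
      exact Fin.ext (by omega)
  have h2 : (⌊(K : ℝ) - t⌋₊ : ℝ) ≤ K - t := Nat.floor_le (by linarith)
  calc _ ≤ ((⌊(K : ℝ) - t⌋₊ + 1 : ℕ) : ℝ) := by exact_mod_cast h1
    _ ≤ _ := by push_cast; linarith

/-- Nearest grid point in the closed cube. -/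
lemma exists_gridPoint_round {K : ℕ} {x : EuclideanSpace ℝ (Fin d)} (hx : x ∈ unitCube d) :
    ∃ k : Fin d → Fin (K + 1), ∀ i, ((k i : ℕ) : ℝ) = round (K * x i) := by
  have h0 : ∀ i, 0 ≤ round ((K : ℝ) * x i) := fun i => by
    have : 0 ≤ (K : ℝ) * x i := mul_nonneg (by positivity) (hx i).1.le
    rw [round_eq]
    exact Int.floor_nonneg.2 (by linarith)
  have h1 : ∀ i, round ((K : ℝ) * x i) ≤ K := fun i => by
    have : (K : ℝ) * x i ≤ K := mul_le_of_le_one_right (by positivity) (hx i).2.le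
    rw [round_eq]
    refine Int.lt_add_one_iff.1 (Int.floor_lt.2 ?_)
    push_cast
    linarith
  refine ⟨fun i => ⟨(round ((K : ℝ) * x i)).toNat, by have := h0 i; have := h1 i; omega⟩,
    fun i => ?_⟩
  have := Int.toNat_of_nonneg (h0 i)
  simp only
  exact_mod_cast this

end Grid

/-! ### Admissible configurations from grids and shrinking. -/

section Construction

variable {d : ℕ}

/-- A full grid of balls. -/
lemma exists_admissible_grid {τ C : ℝ}
    (hC : ∀ K : ℝ, 0 < K → ∀ R U : Set (EuclideanSpace ℝ (Fin d)), volume R ≠ ⊤ → U ⊆ R →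
      (∀ x ∈ U, ∃ i, τ < |K * x i - round (K * x i)|) →
      TorsionBound U (C * volume.real R / K ^ 2))
    (hd : 1 ≤ d) {a : ℝ} (ha : 0 < a) {N K : ℕ} (hN : 0 < N) (hK : 0 < K)
    (hKr : Real.sqrt d * τ / K ≤ a * (N : ℝ) ^ (-(1 / (d : ℝ))))
    (hcard : d * (K + 1) ^ d ≤ N) :
    ∃ S ∈ admissible a N (unitCube d),
      TorsionBound (unitCube d \ S) (C * volume.real (unitCube d) / K ^ 2) := by
  classical
  set r := a * (N : ℝ) ^ (-(1 / (d : ℝ))) with hr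
  have hr0 : 0 < r := by positivity
  set T := gridSlab d K fun _ => True
  have hmemT : ∀ k : Fin d → Fin (K + 1), gridPoint k ∈ T := fun k =>
    mem_gridSlab.2 ⟨k, ⟨⟨0, hd⟩, trivial⟩, rfl⟩
  refine ⟨ballTrace r T, ballTrace_mem_admissible hr ⟨_, hmemT 0⟩ ?_ ?_, ?_⟩
  · refine (card_gridSlab_le d K _).trans (le_trans ?_ hcard)
    simp only [Finset.filter_true, Finset.card_univ, Fintype.card_fin]
    rw [← pow_succ', Nat.sub_add_cancel hd]
  · intro p hp
    obtain ⟨k, -, rfl⟩ := mem_gridSlab.1 hp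
    exact gridPoint_mem_thickening hK k hr0
  · refine hC K (by exact_mod_cast hK) _ _ volume_unitCube_ne_top sdiff_subset fun x hx => ?_
    by_contra! h
    obtain ⟨k, hk⟩ := exists_gridPoint_round (K := K) hx.1
    refine hx.2 (mem_ballTrace hx.1 (hmemT k) ((dist_gridPoint_le hK k fun i => ?_).trans hKr))
    rw [hk]
    exact h i

/-- Shrinking a configuration into the cube `(0,s)^d`, separating this cube from the rest of the
unit cube by balls, and putting a grid of balls into the rest. -/
lemma exists_admissible_shrink {τ C : ℝ} (hC0 : 0 ≤ C)
    (hC : ∀ K : ℝ, 0 < K → ∀ R U : Set (EuclideanSpace ℝ (Fin d)), volume R ≠ ⊤ → U ⊆ R →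
      (∀ x ∈ U, ∃ i, τ < |K * x i - round (K * x i)|) →
      TorsionBound U (C * volume.real R / K ^ 2))
    (hd : 1 ≤ d) {a b s : ℝ} (ha : 0 < a) (hs : 0 < s) (hs1 : s ≤ 1)
    {n N K L : ℕ} (hN : 0 < N) (hK : 0 < K) (hL : 0 < L)
    (hKr : Real.sqrt d * τ / K ≤ a * (N : ℝ) ^ (-(1 / (d : ℝ))))
    (hLr : Real.sqrt d / L ≤ a * (N : ℝ) ^ (-(1 / (d : ℝ))))
    (hsr : s * (b * (n : ℝ) ^ (-(1 / (d : ℝ)))) ≤ a * (N : ℝ) ^ (-(1 / (d : ℝ))))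
    (hcard : (n : ℝ) + d * ((K * (1 - s) + 2) * (K + 1) ^ (d - 1)) + d * (L + 1) ^ (d - 1) ≤ N)
    {S : Set (EuclideanSpace ℝ (Fin d))} (hS : S ∈ admissible b n (unitCube d)) {M : ℝ}
    (hM : 0 ≤ M) (hSM : TorsionBound (unitCube d \ S) M) :
    ∃ S' ∈ admissible a N (unitCube d), TorsionBound (unitCube d \ S')
      (M + C * ((1 - s ^ d) * volume.real (unitCube d)) / K ^ 2) := by
  classical
  obtain ⟨y, hy, rfl⟩ := hS
  set r := a * (N : ℝ) ^ (-(1 / (d : ℝ))) with hr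
  set r' := b * (n : ℝ) ^ (-(1 / (d : ℝ))) with hr'
  have hr0 : 0 < r := by positivity
  have hK' : (0 : ℝ) < K := by exact_mod_cast hK
  have hL' : (0 : ℝ) < L := by exact_mod_cast hL
  -- `T1` is the shrunken configuration, `T2` the grid filling the shell, `T3` the wall along the
  -- faces `x_i = s`. The offset `1/2` in `T2` retains the nearest grid point of any `x` with `x_i >
  -- s`.
  set T1 : Finset (EuclideanSpace ℝ (Fin d)) := Finset.univ.image fun i => s • y i
  set T2 := gridSlab d K fun j => K * s - 1 / 2 ≤ (j : ℝ)
  set T3 := gridSlab d L fun j => ((j : ℕ) : ℝ) = ⌊(L : ℝ) * s⌋₊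
  set T := T1 ∪ T2 ∪ T3
  have hT1 : T1 ⊆ T := fun _ h => Finset.mem_union_left _ (Finset.mem_union_left _ h)
  have hT2 : T2 ⊆ T := fun _ h => Finset.mem_union_left _ (Finset.mem_union_right _ h)
  have hT3 : T3 ⊆ T := fun _ h => Finset.mem_union_right _ h
  have hLs : ⌊(L : ℝ) * s⌋₊ < L + 1 := by
    refine Nat.lt_succ_iff.2 (Nat.floor_le_of_le ?_)
    exact mul_le_of_le_one_right hL'.le hs1
  have hTne : T.Nonempty := by
    refine ⟨gridPoint (K := L) (fun _ => ⟨⌊(L : ℝ) * s⌋₊, hLs⟩), hT3 (mem_gridSlab.2 ?_)⟩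
    exact ⟨_, ⟨⟨0, hd⟩, rfl⟩, rfl⟩
  have hTcard : T.card ≤ N := by
    have c1 : (T1.card : ℝ) ≤ n := by
      exact_mod_cast Finset.card_image_le.trans (by simp)
    have c2 : (T2.card : ℝ) ≤ d * ((K * (1 - s) + 2) * (K + 1) ^ (d - 1)) := by
      have h := card_gridSlab_le d K fun j => K * s - 1 / 2 ≤ (j : ℝ)
      have h' := card_filter_le_index K (t := K * s - 1 / 2) (by nlinarith)
      have h2 : (T2.card : ℝ) ≤ d * ((Finset.univ.filter fun j : Fin (K + 1) =>
          K * s - 1 / 2 ≤ (j : ℝ)).card * (K + 1) ^ (d - 1)) := by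
        norm_cast
      refine h2.trans ?_
      gcongr
      exact h'.trans (by linarith)
    have c3 : (T3.card : ℝ) ≤ d * (L + 1) ^ (d - 1) := by
      have h := card_gridSlab_le d L fun j => ((j : ℕ) : ℝ) = ⌊(L : ℝ) * s⌋₊
      have h' : (Finset.univ.filter fun j : Fin (L + 1) =>
          ((j : ℕ) : ℝ) = ⌊(L : ℝ) * s⌋₊).card ≤ 1 := by
        refine Finset.card_le_one.2 fun i hi j hj => Fin.ext ?_
        exact_mod_cast (Finset.mem_filter.1 hi).2.trans (Finset.mem_filter.1 hj).2.symm
      have h2 : T3.card ≤ d * (1 * (L + 1) ^ (d - 1)) := by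
        refine h.trans ?_
        gcongr
      rw [one_mul] at h2
      exact_mod_cast h2
    have h1 : T.card ≤ T1.card + T2.card + T3.card :=
      (Finset.card_union_le _ _).trans (by gcongr; exact Finset.card_union_le _ _)
    have h2 : (T.card : ℝ) ≤ T1.card + T2.card + T3.card := by exact_mod_cast h1
    exact_mod_cast (show (T.card : ℝ) ≤ N by linarith)
  refine ⟨ballTrace r T, ballTrace_mem_admissible hr hTne hTcard fun p hp => ?_, ?_⟩
  · rcases Finset.mem_union.1 hp with hp | hp
    · rcases Finset.mem_union.1 hp with hp | hp
      · obtain ⟨i, -, rfl⟩ := Finset.mem_image.1 hp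
        obtain ⟨z, hz, hyz⟩ := Metric.mem_thickening_iff.1 (hy i)
        refine Metric.mem_thickening_iff.2 ⟨s • z, fun j => ?_, ?_⟩
        · have := hz j
          exact ⟨mul_pos hs this.1, (mul_le_of_le_one_left this.1.le hs1).trans_lt this.2⟩
        · rw [dist_smul₀, Real.norm_of_nonneg hs.le]
          exact (mul_lt_mul_of_pos_left hyz hs).trans_le hsr
      · obtain ⟨k, -, rfl⟩ := mem_gridSlab.1 hp
        exact gridPoint_mem_thickening hK k hr0
    · obtain ⟨k, -, rfl⟩ := mem_gridSlab.1 hp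
      exact gridPoint_mem_thickening hL k hr0
  · set V : Set (EuclideanSpace ℝ (Fin d)) := {x | ∃ i, s < x i} with hVdef
    have hV : IsOpen V := by
      rw [hVdef, ofPred_exists]
      exact isOpen_iUnion fun i => isOpen_lt continuous_const (by fun_prop)
    have hdisj : Disjoint (cube d s) V := by
      refine Set.disjoint_left.2 ?_
      rintro x hx ⟨i, hi⟩
      exact absurd (hx i).2 (not_lt.2 hi.le)
    refine TorsionBound.glue hM ?_ ?_ ?_ (isOpen_cube s) hV hdisj ?_
    · have : s ^ d ≤ 1 := pow_le_one₀ hs.le hs1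
      have : 0 ≤ 1 - s ^ d := by linarith
      positivity
    · refine (hSM.smul hM hs hs1).anti ?_
      rintro x ⟨⟨hx, hxS⟩, hxs⟩
      rw [← smul_unitCube hs] at hxs
      obtain ⟨z, hz, rfl⟩ := hxs
      refine Set.smul_mem_smul_set ⟨hz, fun hzS => hxS ?_⟩
      obtain ⟨i, hi⟩ := mem_iUnion.1 hzS.2
      refine mem_ballTrace hx (hT1 (Finset.mem_image_of_mem _ (Finset.mem_univ i))) ?_
      simp only
      rw [dist_smul₀, Real.norm_of_nonneg hs.le]
      exact (mul_le_mul_of_nonneg_left (Metric.mem_closedBall.1 hi) hs.le).trans hsr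
    · rw [← volume_real_unitCube_diff_cube hs hs1]
      refine hC K hK' _ _ (measure_ne_top_of_subset sdiff_subset volume_unitCube_ne_top) ?_ ?_
      · rintro x ⟨⟨hx, -⟩, hxV⟩
        exact ⟨hx, fun h => Set.disjoint_left.1 hdisj h hxV⟩
      · rintro x ⟨⟨hx, hxS⟩, i, hi⟩
        by_contra! h
        obtain ⟨k, hk⟩ := exists_gridPoint_round (K := K) hx
        refine hxS (mem_ballTrace hx (hT2 (mem_gridSlab.2 ⟨k, ⟨i, ?_⟩, rfl⟩))
          ((dist_gridPoint_le hK k fun j => ?_).trans hKr))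
        · rw [hk]
          have h1 := abs_le.1 (abs_sub_round ((K : ℝ) * x i))
          have h2 : (K : ℝ) * s ≤ K * x i := by gcongr
          linarith [h1.2]
        · rw [hk]
          exact h j
    -- A point in neither piece has all coordinates at most `s` and one equal to `s`; rounding every
    -- coordinate down on the grid of mesh `1/L` reaches the centre of a wall ball that contains it.
    · rintro x ⟨hx, hxS⟩
      by_contra hcon
      simp only [mem_union, not_or, hVdef, mem_ofPred_eq, not_exists, not_lt] at hcon
      obtain ⟨hxQ, hxV⟩ := hcon
      obtain ⟨i, hi⟩ : ∃ i, x i = s := by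
        by_contra! h
        exact hxQ fun i => ⟨(hx i).1, lt_of_le_of_ne (hxV i) (h i)⟩
      have hk : ∀ j, ⌊(L : ℝ) * x j⌋₊ < L + 1 := fun j => by
        refine lt_of_le_of_lt (Nat.floor_mono ?_) hLs
        gcongr
        exact hxV j
      refine hxS (mem_ballTrace hx (hT3 (mem_gridSlab.2
        ⟨fun j => ⟨⌊(L : ℝ) * x j⌋₊, hk j⟩, ⟨i, ?_⟩, rfl⟩))
        ((dist_gridPoint_le hL (τ := 1) _ fun j => ?_).trans (by simpa using hLr)))
      · simp [hi]
      · have h0 : 0 ≤ (L : ℝ) * x j := mul_nonneg hL'.le (hx j).1.le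
        simp only
        rw [abs_le]
        constructor <;> linarith [Nat.floor_le h0, Nat.lt_floor_add_one ((L : ℝ) * x j)]

end Construction

/-! ### Monotonicity, finiteness and right continuity of `theta`. -/

section Theta

variable {d : ℕ}

lemma admissible_unitCube_nonempty {a : ℝ} (ha : 0 < a) (n : ℕ) :
    (admissible a n (unitCube d)).Nonempty := by
  obtain ⟨c, hc⟩ := unitCube_nonempty (d := d)
  refine ⟨_, fun _ => c, fun i => ?_, rfl⟩
  have : 0 < n := i.pos
  exact Metric.self_subset_thickening (by positivity) _ hc

/-- A lower limit only sees a subsequence; at the other indices any admissible set will do. -/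
lemma theta_le_of_frequently {a : ℝ} (ha : 0 < a) {L : ℝ≥0∞}
    (h : ∃ᶠ n : ℕ in atTop, ∃ S ∈ admissible a n (unitCube d),
      ENNReal.ofReal ((n : ℝ) ^ (2 / (d : ℝ)) * compliance S (fun _ => 1) (unitCube d)) ≤ L) :
    theta d a ≤ L := by
  classical
  have key : ∀ n, ∃ S ∈ admissible a n (unitCube d),
      (∃ S ∈ admissible a n (unitCube d),
        ENNReal.ofReal ((n : ℝ) ^ (2 / (d : ℝ)) * compliance S (fun _ => 1) (unitCube d)) ≤ L) →
      ENNReal.ofReal ((n : ℝ) ^ (2 / (d : ℝ)) * compliance S (fun _ => 1) (unitCube d)) ≤ L := by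
    intro n
    by_cases hn : ∃ S ∈ admissible a n (unitCube d),
        ENNReal.ofReal ((n : ℝ) ^ (2 / (d : ℝ)) * compliance S (fun _ => 1) (unitCube d)) ≤ L
    · obtain ⟨S, hS, hSL⟩ := hn
      exact ⟨S, hS, fun _ => hSL⟩
    · obtain ⟨S, hS⟩ := admissible_unitCube_nonempty (d := d) ha n
      exact ⟨S, hS, fun h => absurd h hn⟩
  choose S hS hSL using key
  refine (iInf₂_le S hS).trans (liminf_le_of_frequently_le' (h.mono fun n hn => hSL n hn))

lemma frequently_of_theta_lt {a : ℝ} {L : ℝ≥0∞} (h : theta d a < L) :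
    ∃ᶠ n : ℕ in atTop, ∃ S ∈ admissible a n (unitCube d),
      ENNReal.ofReal ((n : ℝ) ^ (2 / (d : ℝ)) * compliance S (fun _ => 1) (unitCube d)) < L := by
  simp only [theta, iInf_lt_iff] at h
  obtain ⟨S, hS, hlt⟩ := h
  exact (frequently_lt_of_liminf_lt isCobounded_ge_of_top hlt).mono fun n hn => ⟨S n, hS n, hn⟩

/-- Keep the centres and enlarge the balls. -/
lemma theta_anti (hd : 1 ≤ d) {a b : ℝ} (ha : 0 < a) (hab : a ≤ b) : theta d b ≤ theta d a := by
  refine le_of_forall_gt_imp_ge_of_dense fun L hL => ?_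
  refine theta_le_of_frequently (ha.trans_le hab) ((frequently_of_theta_lt hL).mono fun n hn => ?_)
  obtain ⟨S, ⟨x, hx, rfl⟩, hS⟩ := hn
  have hr : a * (n : ℝ) ^ (-(1 / (d : ℝ))) ≤ b * (n : ℝ) ^ (-(1 / (d : ℝ))) := by gcongr
  refine ⟨_, ⟨x, fun i => Metric.thickening_mono hr _ (hx i), rfl⟩, le_trans ?_ hS.le⟩
  gcongr
  refine compliance_unitCube_le compliance_nonneg ?_
  refine (torsionBound_compliance_unitCube hd _).anti (sdiff_subset_sdiff_right ?_)
  gcongr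

/-- The numerical constants in the estimates of `theta`. -/
lemma exists_lattice_constants (hd : 1 ≤ d) {a : ℝ} (ha : 0 < a) :
    ∃ τ C : ℝ, 0 ≤ C ∧ (∀ K : ℝ, 0 < K → ∀ R U : Set (EuclideanSpace ℝ (Fin d)), volume R ≠ ⊤ →
      U ⊆ R → (∀ x ∈ U, ∃ i, τ < |K * x i - round (K * x i)|) →
      TorsionBound U (C * volume.real R / K ^ 2)) ∧
      ∀ K ν : ℝ, 0 < ν → ν / (16 * d) ≤ K → Real.sqrt d * τ / K ≤ a / (2 * ν) := by
  have hd' : (0 : ℝ) < d := by exact_mod_cast hd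
  -- Chosen so that, for `K ≥ ν / (16 d)`, a cell of half-side `τ / K` about a grid point fits into
  -- a ball of radius `a / (2ν)`.
  set τ : ℝ := a / (32 * d * Real.sqrt d)
  obtain ⟨C, hC0, hC⟩ := exists_torsionBound_lattice d (τ := τ) (by positivity)
  refine ⟨τ, C, hC0.le, hC, fun K ν hν hK => ?_⟩
  have hK0 : 0 < K := lt_of_lt_of_le (by positivity) hK
  have h1 : Real.sqrt d * τ = a / (32 * d) := by
    have : Real.sqrt d ≠ 0 := by positivity
    simp only [τ]; field_simp
  rw [h1, div_div, div_le_div_iff_of_pos_left ha (by positivity) (by positivity)]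
  rw [div_le_iff₀ (by positivity)] at hK
  linarith

lemma rpow_inv_pow (hd : 1 ≤ d) (n : ℕ) : ((n : ℝ) ^ (1 / (d : ℝ))) ^ d = n := by
  rw [one_div]
  exact Real.rpow_inv_natCast_pow (by positivity) (by omega)

lemma rpow_two_div (n : ℕ) : (n : ℝ) ^ (2 / (d : ℝ)) = ((n : ℝ) ^ (1 / (d : ℝ))) ^ 2 := by
  rw [← Real.rpow_natCast, ← Real.rpow_mul (by positivity)]
  congr 1
  push_cast; ring

lemma rpow_neg_one_div (n : ℕ) : (n : ℝ) ^ (-(1 / (d : ℝ))) = ((n : ℝ) ^ (1 / (d : ℝ)))⁻¹ :=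
  Real.rpow_neg (by positivity) _

lemma tendsto_rpow_one_div (hd : 1 ≤ d) :
    Tendsto (fun n : ℕ => (n : ℝ) ^ (1 / (d : ℝ))) atTop atTop :=
  (tendsto_rpow_atTop (by have : (0 : ℝ) < d := by exact_mod_cast hd
                          positivity)).comp tendsto_natCast_atTop_atTop

/-- The grid parameter `K = ⌊ν / (8d)⌋` is comparable to `ν = n^{1/d}`, yet so small that the grid
uses only a fraction of `n` balls. -/
lemma floor_mesh_bounds {d : ℝ} (hd : 1 ≤ d) {ν : ℝ} (hν : 16 * d ≤ ν) :
    ν / (16 * d) ≤ (⌊ν / (8 * d)⌋₊ : ℝ) ∧ (⌊ν / (8 * d)⌋₊ : ℝ) ≤ ν / (8 * d) ∧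
      (⌊ν / (8 * d)⌋₊ : ℝ) + 1 ≤ ν / (4 * d) := by
  have hν0 : 0 ≤ ν := by linarith
  have h1 : (⌊ν / (8 * d)⌋₊ : ℝ) ≤ ν / (8 * d) := Nat.floor_le (by positivity)
  have h2 := Nat.lt_floor_add_one (ν / (8 * d))
  have h3 : 1 ≤ ν / (16 * d) := by rw [le_div_iff₀ (by positivity)]; linarith
  have h4 : ν / (8 * d) = 2 * (ν / (16 * d)) := by field_simp; ring
  have h5 : ν / (4 * d) = 4 * (ν / (16 * d)) := by field_simp; ring
  refine ⟨by linarith, h1, by linarith⟩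

/-- A full grid with `K` of order `n^{1/d}` has compliance of order `K⁻²`, which the factor
`n^{2/d}` compensates. -/
lemma theta_lt_top (hd : 1 ≤ d) {a : ℝ} (ha : 0 < a) : theta d a < ⊤ := by
  have hd' : (1 : ℝ) ≤ d := by exact_mod_cast hd
  obtain ⟨τ, C, hC0, hC, hτ⟩ := exists_lattice_constants hd ha
  set D : ℝ := C * volume.real (unitCube d) * (16 * d) ^ 2
  refine (theta_le_of_frequently ha (L := ENNReal.ofReal D) (Eventually.frequently ?_)).trans_lt
    ENNReal.ofReal_lt_top
  filter_upwards [(tendsto_rpow_one_div hd).eventually_ge_atTop (16 * d), eventually_gt_atTop 0]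
    with n hν hn
  set ν := (n : ℝ) ^ (1 / (d : ℝ)) with hνdef
  have hν0 : 0 < ν := by linarith
  obtain ⟨k1, k2, k3⟩ := floor_mesh_bounds hd' hν
  set K := ⌊ν / (8 * d)⌋₊
  have hK0 : (0 : ℝ) < K := lt_of_lt_of_le (by positivity) k1
  obtain ⟨S, hS, hSM⟩ := exists_admissible_grid hC hd ha hn (by exact_mod_cast hK0)
    (K := K) (by
      rw [rpow_neg_one_div, ← hνdef]
      refine (hτ K ν hν0 k1).trans ?_
      rw [← div_eq_mul_inv]
      gcongr
      linarith) (by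
      have h1 : (d : ℝ) * (K + 1) ^ d ≤ ν ^ d := by
        calc (d : ℝ) * (K + 1) ^ d ≤ d * (ν / (4 * d)) ^ d := by gcongr
          _ = d * (1 / (4 * d)) ^ d * ν ^ d := by rw [div_eq_mul_one_div, mul_pow]; ring
          _ ≤ d * (1 / (4 * d)) ^ 1 * ν ^ d := by
            have : (1 : ℝ) / (4 * d) ≤ 1 := by rw [div_le_one (by positivity)]; linarith
            have := pow_le_pow_of_le_one (by positivity) this hd
            gcongr
          _ = 1 / 4 * ν ^ d := by field_simp
          _ ≤ ν ^ d := by linarith [pow_pos hν0 d]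
      rw [hνdef, rpow_inv_pow hd] at h1
      exact_mod_cast h1)
  refine ⟨S, hS, ENNReal.ofReal_le_ofReal ?_⟩
  have hc := compliance_unitCube_le (by positivity) hSM
  rw [rpow_two_div, ← hνdef]
  calc ν ^ 2 * compliance S (fun _ => 1) (unitCube d)
      ≤ ν ^ 2 * (C * volume.real (unitCube d) / K ^ 2) := by gcongr
    _ ≤ ν ^ 2 * (C * volume.real (unitCube d) / (ν / (16 * d)) ^ 2) := by gcongr
    _ = D := by simp only [D]; field_simp

lemma one_sub_two_mul_le_inv_sq {δ : ℝ} (hδ : 0 < δ) : 1 - 2 * δ ≤ ((1 + δ) ^ 2)⁻¹ := by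
  rw [← one_div, le_div_iff₀ (by positivity)]
  nlinarith [pow_pos hδ 2, pow_pos hδ 3]

/-- Comparison of `theta` at nearby points. -/
lemma exists_theta_le (hd : 1 ≤ d) {a : ℝ} (ha : 0 < a) :
    ∃ D : ℝ, ∀ δ b : ℝ, 0 < δ → δ ≤ 1 → a ≤ b → b ^ d ≤ (1 + δ) * a ^ d → ∀ L, theta d b < L →
      theta d a ≤ ENNReal.ofReal ((1 + δ) ^ 2) * L + ENNReal.ofReal (D * δ) := by
  have hd' : (1 : ℝ) ≤ d := by exact_mod_cast hd
  obtain ⟨τ, C, hC0, hC, hτ⟩ := exists_lattice_constants hd ha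
  set D : ℝ := 8 * (C * volume.real (unitCube d) * (16 * d) ^ 2)
  refine ⟨D, fun δ b hδ hδ1 hab hbδ L hL => ?_⟩
  have hb : 0 < b := ha.trans_le hab
  set e := (1 + δ) ^ (1 / (d : ℝ)) with he
  have hed : e ^ d = 1 + δ := by
    rw [he, one_div]
    exact Real.rpow_inv_natCast_pow (by positivity) (by omega)
  have he1 : 1 ≤ e := Real.one_le_rpow (by linarith) (by positivity)
  have heδ : e ≤ 1 + δ := by
    rw [← hed]; exact le_self_pow₀ he1 (by omega)
  -- With `N ≤ (1 + δ) n` one has `N^{1/d} ≤ e n^{1/d}`, so balls of radius `b n^{-1/d}` shrunk by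
  -- `s` have radius at most `a N^{-1/d}`.
  set s := a / (b * e)
  have hs : 0 < s := by positivity
  have hs1 : s ≤ 1 := by
    rw [div_le_one (by positivity)]
    nlinarith
  have hsd : 1 - s ^ d ≤ 2 * δ := by
    have h1 : ((1 + δ) ^ 2)⁻¹ ≤ s ^ d := by
      simp only [s]
      rw [div_pow, mul_pow, hed, inv_le_comm₀ (by positivity) (by positivity), inv_div,
        div_le_iff₀ (by positivity)]
      nlinarith
    linarith [one_sub_two_mul_le_inv_sq hδ]
  have hs2 : 1 - s ≤ 2 * δ := by
    have : s ^ d ≤ s := pow_le_of_le_one hs.le hs1 (by omega)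
    linarith
  set cL : ℝ := 2 * Real.sqrt d / a + 2
  -- Collects the terms of order `n^{(d-1)/d}` in the count of balls: the grid's rounding, the wall,
  -- and the floor in `N`. They fit into `δ n / 2` once `ν ≥ 2 C3 / δ`; the grid's main term takes
  -- at most `δ n / 4`.
  set C3 : ℝ := d * (2 + cL ^ (d - 1)) + 1
  refine theta_le_of_frequently ha (frequently_atTop.2 fun m => ?_)
  obtain ⟨n, ⟨S, hS, hSL⟩, hν, hν2, hν3, hn, hnm⟩ := ((frequently_of_theta_lt hL).and_eventually
    (((tendsto_rpow_one_div hd).eventually_ge_atTop (16 * d)).and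
      (((tendsto_rpow_one_div hd).eventually_ge_atTop 1).and
      (((tendsto_rpow_one_div hd).eventually_ge_atTop (2 * C3 / δ)).and
        ((eventually_gt_atTop 0).and (eventually_ge_atTop m)))))).exists
  set ν := (n : ℝ) ^ (1 / (d : ℝ)) with hνdef
  have hν0 : 0 < ν := by linarith
  have hνd : ν ^ d = n := rpow_inv_pow hd n
  obtain ⟨k1, k2, k3⟩ := floor_mesh_bounds hd' hν
  set K := ⌊ν / (8 * d)⌋₊
  have hK0 : (0 : ℝ) < K := lt_of_lt_of_le (by positivity) k1
  set N := ⌊(1 + δ) * n⌋₊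
  have hN1 : (N : ℝ) ≤ (1 + δ) * n := Nat.floor_le (by positivity)
  have hN2 : (1 + δ) * n < N + 1 := Nat.lt_floor_add_one _
  have hnN : n ≤ N := Nat.le_floor (by nlinarith)
  set ν' := (N : ℝ) ^ (1 / (d : ℝ)) with hν'def
  have hνν' : ν ≤ ν' := by
    have : (n : ℝ) ≤ N := by exact_mod_cast hnN
    simp only [hνdef, hν'def]; gcongr
  have hν'0 : 0 < ν' := hν0.trans_le hνν'
  have hν' : ν' ≤ e * ν := by
    simp only [hνdef, hν'def, he]
    rw [← Real.mul_rpow (by positivity) (by positivity)]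
    gcongr
  have hr : a / (2 * ν) ≤ a * (N : ℝ) ^ (-(1 / (d : ℝ))) := by
    rw [rpow_neg_one_div, ← hν'def, ← div_eq_mul_inv]
    gcongr
    nlinarith
  set ℓ := ⌈2 * Real.sqrt d * ν / a⌉₊
  have hℓ1 : 2 * Real.sqrt d * ν / a ≤ ℓ := Nat.le_ceil _
  have hℓ2 : (ℓ : ℝ) < 2 * Real.sqrt d * ν / a + 1 := Nat.ceil_lt_add_one (by positivity)
  have hℓ0 : (0 : ℝ) < ℓ := lt_of_lt_of_le (by positivity) hℓ1
  have hℓ3 : (ℓ : ℝ) + 1 ≤ cL * ν := by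
    have : cL * ν = 2 * Real.sqrt d * ν / a + 2 * ν := by simp only [cL]; ring
    linarith
  obtain ⟨S', hS', hSM⟩ := exists_admissible_shrink hC0 hC hd ha hs hs1 (n := n) (N := N) (b := b)
    (K := K) (L := ℓ) (by omega) (by exact_mod_cast hK0) (by exact_mod_cast hℓ0)
    ((hτ K ν hν0 k1).trans hr) (by
      refine le_trans ?_ hr
      rw [div_le_div_iff₀ hℓ0 (by positivity)]
      rw [div_le_iff₀ ha] at hℓ1
      linarith) (by
      rw [rpow_neg_one_div, rpow_neg_one_div, ← hνdef, ← hν'def, ← div_eq_mul_inv,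
        ← div_eq_mul_inv]
      have : s * (b / ν) = a / (e * ν) := by simp only [s]; field_simp
      rw [this]
      gcongr) (by
      have h1 : (d : ℝ) * ((K * (1 - s) + 2) * (K + 1) ^ (d - 1)) ≤
          d * ((ν / (8 * d) * (2 * δ) + 2) * (ν / (4 * d)) ^ (d - 1)) := by
        have : 0 ≤ 1 - s := by linarith
        gcongr
      have hq : (1 : ℝ) / (4 * d) ≤ 1 := by rw [div_le_one (by positivity)]; linarith
      have h2 : (ν / (4 * d)) ^ (d - 1) ≤ ν ^ (d - 1) := by
        gcongr
        exact div_le_self hν0.le (by linarith)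
      have hpow : ν * ν ^ (d - 1) = n := by rw [← pow_succ', Nat.sub_add_cancel hd, hνd]
      have h3 : (d : ℝ) * ((ν / (8 * d) * (2 * δ) + 2) * (ν / (4 * d)) ^ (d - 1)) ≤
          δ / 4 * n + 2 * d * ν ^ (d - 1) := by
        calc _ ≤ (d : ℝ) * ((ν / (8 * d) * (2 * δ) + 2) * ν ^ (d - 1)) := by gcongr
          _ = δ / 4 * (ν * ν ^ (d - 1)) + 2 * d * ν ^ (d - 1) := by field_simp; ring
          _ = _ := by rw [hpow]
      have h4 : (d : ℝ) * (ℓ + 1) ^ (d - 1) ≤ d * cL ^ (d - 1) * ν ^ (d - 1) := by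
        calc _ ≤ (d : ℝ) * (cL * ν) ^ (d - 1) := by gcongr
          _ = _ := by rw [mul_pow]; ring
      have h5 : (1 : ℝ) ≤ ν ^ (d - 1) := one_le_pow₀ hν2
      have h6 : C3 * ν ^ (d - 1) ≤ δ / 2 * n := by
        rw [div_le_iff₀ hδ] at hν3
        rw [← hpow]
        have : C3 ≤ δ / 2 * ν := by linarith
        calc C3 * ν ^ (d - 1) ≤ (δ / 2 * ν) * ν ^ (d - 1) := by gcongr
          _ = _ := by ring
      have h7 : C3 * ν ^ (d - 1) = 2 * d * ν ^ (d - 1) + d * cL ^ (d - 1) * ν ^ (d - 1)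
          + ν ^ (d - 1) := by simp only [C3]; ring
      have h8 : 0 ≤ δ * n := by positivity
      linarith)
    hS compliance_nonneg (torsionBound_compliance_unitCube hd S)
  refine ⟨N, hnm.trans hnN, S', hS', ?_⟩
  have hs0 : 0 ≤ 1 - s ^ d := by
    have : s ^ d ≤ 1 := pow_le_one₀ hs.le hs1
    linarith
  have hF := compliance_nonneg (S := S) (Ω := unitCube d)
  set F := compliance S (fun _ => 1) (unitCube d)
  have hc := compliance_unitCube_le (by positivity) hSM
  have hν'2 : ν' ^ 2 ≤ (1 + δ) ^ 2 * ν ^ 2 := by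
    rw [← mul_pow]
    gcongr
    exact hν'.trans (by gcongr)
  have hF' := compliance_nonneg (S := S') (Ω := unitCube d)
  have hmain : ν' ^ 2 * compliance S' (fun _ => 1) (unitCube d) ≤
      (1 + δ) ^ 2 * (ν ^ 2 * F) + D * δ := by
    calc _ ≤ ((1 + δ) ^ 2 * ν ^ 2) *
          (F + C * ((1 - s ^ d) * volume.real (unitCube d)) / K ^ 2) := by gcongr
      _ = (1 + δ) ^ 2 * (ν ^ 2 * F) +
          (1 + δ) ^ 2 * ν ^ 2 * (C * ((1 - s ^ d) * volume.real (unitCube d)) / K ^ 2) := by ring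
      _ ≤ (1 + δ) ^ 2 * (ν ^ 2 * F) +
          2 ^ 2 * ν ^ 2 * (C * ((2 * δ) * volume.real (unitCube d)) / (ν / (16 * d)) ^ 2) := by
        gcongr
        linarith
      _ = _ := by simp only [D]; field_simp; ring
  rw [rpow_two_div, ← hν'def]
  refine (ENNReal.ofReal_le_ofReal hmain).trans (ENNReal.ofReal_add_le.trans ?_)
  gcongr
  rw [ENNReal.ofReal_mul (by positivity)]
  gcongr
  rw [rpow_two_div, ← hνdef] at hSL
  exact hSL.le

/-- `theta` is right continuous. -/
lemma theta_eq_thetaMinus (hd : 1 ≤ d) {a : ℝ} (ha : 0 < a) : theta d a = thetaMinus d a := by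
  have hle : thetaMinus d a ≤ theta d a := iSup₂_le fun b hb => theta_anti hd ha hb.le
  refine le_antisymm ?_ hle
  have hfin : thetaMinus d a ≠ ⊤ := (hle.trans_lt (theta_lt_top hd ha)).ne
  obtain ⟨D, hD⟩ := exists_theta_le hd ha
  -- The comparison is applied with `b = (1 + δ)^{1/d} a` and the strict upper bound `θ⁻(a) + δ` for
  -- `θ(b)`, then `δ → 0`.
  have hlim : Tendsto (fun δ : ℝ => ENNReal.ofReal ((1 + δ) ^ 2) *
      (thetaMinus d a + ENNReal.ofReal δ) + ENNReal.ofReal (D * δ)) (𝓝[>] 0)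
      (𝓝 (thetaMinus d a)) := by
    have h1 : Tendsto (fun δ : ℝ => ENNReal.ofReal ((1 + δ) ^ 2)) (𝓝[>] 0) (𝓝 1) := by
      have : Continuous fun δ : ℝ => ENNReal.ofReal ((1 + δ) ^ 2) :=
        ENNReal.continuous_ofReal.comp (by fun_prop)
      simpa using (this.tendsto 0).mono_left nhdsWithin_le_nhds
    have h2 : Tendsto (fun δ : ℝ => ENNReal.ofReal δ) (𝓝[>] 0) (𝓝 0) := by
      simpa using (ENNReal.continuous_ofReal.tendsto 0).mono_left nhdsWithin_le_nhds
    have h3 : Tendsto (fun δ : ℝ => ENNReal.ofReal (D * δ)) (𝓝[>] 0) (𝓝 0) := by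
      have : Continuous fun δ : ℝ => ENNReal.ofReal (D * δ) :=
        ENNReal.continuous_ofReal.comp (by fun_prop)
      simpa using (this.tendsto 0).mono_left nhdsWithin_le_nhds
    have h4 := (tendsto_const_nhds (x := thetaMinus d a)).add h2
    rw [add_zero] at h4
    simpa using (ENNReal.Tendsto.mul h1 (Or.inl one_ne_zero) h4 (Or.inr ENNReal.one_ne_top)).add h3
  refine ge_of_tendsto hlim ?_
  filter_upwards [Ioo_mem_nhdsGT one_pos] with δ hδ
  set e := (1 + δ) ^ (1 / (d : ℝ)) with he
  have hed : e ^ d = 1 + δ := by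
    rw [he, one_div]
    exact Real.rpow_inv_natCast_pow (by linarith [hδ.1]) (by omega)
  have hd' : (1 : ℝ) ≤ d := by exact_mod_cast hd
  have he1 : 1 < e := Real.one_lt_rpow (by linarith [hδ.1]) (by positivity)
  have hab : a < e * a := by nlinarith
  refine hD δ (e * a) hδ.1 hδ.2.le hab.le (by rw [mul_pow, hed]) _ ?_
  refine lt_of_le_of_lt (le_iSup₂ (f := fun (β : ℝ) (_ : a < β) => theta d β) (e * a) hab) ?_
  exact ENNReal.lt_add_right hfin (by simp [hδ.1])

end Theta

/-! ### Multiplier rule for nonconvex integrands on atomless spaces. -/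

section Multiplier

open scoped NNReal

lemma continuous_measureReal_Iic (κ : Measure ℝ) [IsFiniteMeasure κ] [NullSingletonClass κ] :
    Continuous fun t => κ.real (Iic t) := by
  have h : ∀ t, κ.real (Iic t) = κ.real (Iic 0) + ∫ _x in (0 : ℝ)..t, (1 : ℝ) ∂κ := by
    intro t
    have := intervalIntegral.integral_Iic_sub_Iic (μ := κ) (f := fun _ => (1 : ℝ)) (a := 0) (b := t)
      (integrable_const _).integrableOn (integrable_const _).integrableOn
    rw [← this]
    simp
  rw [funext h]
  exact continuous_const.add ((integrable_const (1 : ℝ)).continuous_primitive 0)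

/-- Intermediate value theorem: the sum of the two distribution functions takes the value `κ₂(ℝ)`.
-/
lemma exists_measure_Iic_eq_Ioi (κ₁ κ₂ : Measure ℝ) [IsFiniteMeasure κ₁] [IsFiniteMeasure κ₂]
    [NullSingletonClass κ₁] [NullSingletonClass κ₂] (h1 : κ₁ ≠ 0) (h2 : κ₂ ≠ 0) :
    ∃ t, κ₁ (Iic t) = κ₂ (Ioi t) := by
  have hc : Continuous fun t => κ₁.real (Iic t) + κ₂.real (Iic t) :=
    (continuous_measureReal_Iic κ₁).add (continuous_measureReal_Iic κ₂)
  have hbot : ∀ κ : Measure ℝ, IsFiniteMeasure κ →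
      Tendsto (fun t => κ.real (Iic t)) atBot (𝓝 0) := by
    intro κ _
    have := tendsto_measure_iInter_atBot (μ := κ) (s := fun t : ℝ => Iic t)
      (fun t => measurableSet_Iic.nullMeasurableSet) (fun _ _ h => Iic_subset_Iic.2 h)
      ⟨0, measure_ne_top _ _⟩
    rw [iInter_Iic_eq_empty_iff.2 (by simp), measure_empty] at this
    exact (ENNReal.tendsto_toReal ENNReal.zero_ne_top).comp this
  have htop : ∀ κ : Measure ℝ, IsFiniteMeasure κ →
      Tendsto (fun t => κ.real (Iic t)) atTop (𝓝 (κ.real univ)) := by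
    intro κ _
    exact (ENNReal.tendsto_toReal (measure_ne_top _ _)).comp (tendsto_measure_Iic_atTop κ)
  have p1 : 0 < κ₁.real univ := by
    have : NeZero κ₁ := ⟨h1⟩
    exact measureReal_univ_pos
  have p2 : 0 < κ₂.real univ := by
    have : NeZero κ₂ := ⟨h2⟩
    exact measureReal_univ_pos
  obtain ⟨t, ht⟩ : κ₂.real univ ∈ range fun t => κ₁.real (Iic t) + κ₂.real (Iic t) := by
    refine mem_range_of_exists_le_of_exists_ge hc ?_ ?_
    · have := ((hbot κ₁ inferInstance).add (hbot κ₂ inferInstance)).eventually_lt_const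
        (u := κ₂.real univ) (by simpa using p2)
      exact this.exists.imp fun _ => le_of_lt
    · have := ((htop κ₁ inferInstance).add (htop κ₂ inferInstance)).eventually_const_lt
        (u := κ₂.real univ) (by simpa using p1)
      exact this.exists.imp fun _ => le_of_lt
  refine ⟨t, ?_⟩
  have h3 : κ₂.real (Ioi t) = κ₂.real univ - κ₂.real (Iic t) := by
    rw [← compl_Iic, measureReal_compl measurableSet_Iic]
  have h4 : κ₁.real (Iic t) = κ₂.real (Ioi t) := by
    simp only at ht
    linarith
  exact (ENNReal.toReal_eq_toReal_iff' (measure_ne_top _ _) (measure_ne_top _ _)).1 h4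

/-- Two finite atomless measures on the line have disjoint pieces of the same positive mass. -/
lemma exists_measure_eq_measure_compl (κ₁ κ₂ : Measure ℝ) [IsFiniteMeasure κ₁] [IsFiniteMeasure κ₂]
    [NullSingletonClass κ₁] [NullSingletonClass κ₂] (h1 : κ₁ ≠ 0) (h2 : κ₂ ≠ 0) :
    ∃ B, MeasurableSet B ∧ κ₁ B = κ₂ Bᶜ ∧ κ₁ B ≠ 0 := by
  obtain ⟨t, ht⟩ := exists_measure_Iic_eq_Ioi κ₁ κ₂ h1 h2
  obtain ⟨s, hs⟩ := exists_measure_Iic_eq_Ioi κ₂ κ₁ h2 h1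
  -- If both thresholds gave zero mass, then two null half-lines would cover `ℝ` for one of the
  -- measures, which would vanish.
  by_cases ht0 : κ₁ (Iic t) = 0
  · by_cases hs0 : κ₁ (Ioi s) = 0
    · exfalso
      rw [ht0] at ht
      rw [hs0] at hs
      rcases le_total t s with hts | hst
      · refine h2 (Measure.measure_univ_eq_zero.1 (measure_mono_null ?_
          (measure_union_null hs ht.symm)))
        exact fun x _ => (le_or_gt x s).imp id fun h => hts.trans_lt h
      · refine h1 (Measure.measure_univ_eq_zero.1 (measure_mono_null ?_
          (measure_union_null ht0 hs0)))
        exact fun x _ => (le_or_gt x t).imp id fun h => hst.trans_lt h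
    · exact ⟨Ioi s, measurableSet_Ioi, by rw [compl_Ioi, hs], hs0⟩
  · exact ⟨Iic t, measurableSet_Iic, by rw [compl_Iic, ht], ht0⟩

variable {X : Type*} [MeasurableSpace X] {m : Measure X} [IsFiniteMeasure m]

/-- Mass cannot be moved profitably between two sets by a minimizer. -/
lemma measure_eq_zero_or_of_minimizer {ξ : X → ℝ} (hξ : Measurable ξ)
    (hξ0 : ∀ t, m (ξ ⁻¹' {t}) = 0) {W : X → ℝ≥0∞} (hW : Measurable W) {h : ℝ≥0 → ℝ≥0∞}
    (hh : Measurable h) {ρ : X → ℝ≥0} (hρ : Measurable ρ) (hρfin : ∫⁻ x, ρ x ∂m ≠ ⊤)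
    (hJ : ∫⁻ x, W x * h (ρ x) ∂m ≠ ⊤)
    (hmin : ∀ ρ' : X → ℝ≥0, Measurable ρ' → ∫⁻ x, ρ' x ∂m = ∫⁻ x, ρ x ∂m →
      ∫⁻ x, W x * h (ρ x) ∂m ≤ ∫⁻ x, W x * h (ρ' x) ∂m)
    {p q : ℝ≥0} (hqp : q < p) (y y' : ℝ≥0) :
    m {x | ρ x < y ∧ W x * h y + p * y ≤ W x * h (ρ x) + p * ρ x} = 0 ∨
      m {x | y' < ρ x ∧ W x * h y' + q * y' ≤ W x * h (ρ x) + q * ρ x} = 0 := by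
  set A := {x | ρ x < y ∧ W x * h y + p * y ≤ W x * h (ρ x) + p * ρ x} with hA
  set A' := {x | y' < ρ x ∧ W x * h y' + q * y' ≤ W x * h (ρ x) + q * ρ x} with hA'
  have hAm : MeasurableSet A := (measurableSet_lt hρ measurable_const).inter
    (measurableSet_le (f := fun x => W x * h y + p * y)
      (g := fun x => W x * h (ρ x) + p * ρ x) (by fun_prop) (by fun_prop))
  have hAm' : MeasurableSet A' := (measurableSet_lt measurable_const hρ).inter
    (measurableSet_le (f := fun x => W x * h y' + q * y')
      (g := fun x => W x * h (ρ x) + q * ρ x) (by fun_prop) (by fun_prop))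
  by_contra! hcon
  obtain ⟨hA0, hA0'⟩ := hcon
  set u : X → ℝ≥0∞ := fun x => ((y - ρ x : ℝ≥0) : ℝ≥0∞) with hu
  set v : X → ℝ≥0∞ := fun x => ((ρ x - y' : ℝ≥0) : ℝ≥0∞) with hv
  have hum : Measurable u := by fun_prop
  have hvm : Measurable v := by fun_prop
  -- `κ₁` records the mass needed to raise `ρ` to `y` on `A`, `κ₂` the mass freed by lowering `ρ` to
  -- `y'` on `A'`. Pushed to the line by `ξ`, they can be balanced on disjoint pieces.
  set κ₁ := ((m.restrict A).withDensity u).map ξ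
  set κ₂ := ((m.restrict A').withDensity v).map ξ
  have hκ₁ : ∀ B, MeasurableSet B → κ₁ B = ∫⁻ x in A ∩ ξ ⁻¹' B, u x ∂m := fun B hB => by
    rw [Measure.map_apply hξ hB, withDensity_apply _ (hξ hB), Measure.restrict_restrict (hξ hB),
      inter_comm]
  have hκ₂ : ∀ B, MeasurableSet B → κ₂ B = ∫⁻ x in A' ∩ ξ ⁻¹' B, v x ∂m := fun B hB => by
    rw [Measure.map_apply hξ hB, withDensity_apply _ (hξ hB), Measure.restrict_restrict (hξ hB),
      inter_comm]
  have hρle : ∀ S : Set X, ∫⁻ x in S, ρ x ∂m ≠ ⊤ := fun S =>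
    ((setLIntegral_le_lintegral S _).trans_lt hρfin.lt_top).ne
  have hfin₁ : IsFiniteMeasure κ₁ := ⟨by
    rw [hκ₁ _ MeasurableSet.univ]
    refine (lintegral_mono (g := fun _ => (y : ℝ≥0∞)) fun x => ?_).trans_lt ?_
    · exact ENNReal.coe_le_coe.2 tsub_le_self
    · rw [lintegral_const]
      exact ENNReal.mul_lt_top ENNReal.coe_lt_top (measure_lt_top _ _)⟩
  have hfin₂ : IsFiniteMeasure κ₂ := ⟨by
    rw [hκ₂ _ MeasurableSet.univ]
    refine (lintegral_mono (g := fun x => (ρ x : ℝ≥0∞)) fun x => ?_).trans_lt (hρle _).lt_top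
    exact ENNReal.coe_le_coe.2 tsub_le_self⟩
  have hat₁ : NullSingletonClass κ₁ := ⟨fun t => by
    rw [hκ₁ _ (measurableSet_singleton t)]
    exact setLIntegral_measure_zero _ _ (measure_mono_null inter_subset_right (hξ0 t))⟩
  have hat₂ : NullSingletonClass κ₂ := ⟨fun t => by
    rw [hκ₂ _ (measurableSet_singleton t)]
    exact setLIntegral_measure_zero _ _ (measure_mono_null inter_subset_right (hξ0 t))⟩
  have hne₁ : κ₁ ≠ 0 := fun h0 => by
    have : ∫⁻ x in A ∩ ξ ⁻¹' univ, u x ∂m = 0 := by rw [← hκ₁ _ MeasurableSet.univ, h0]; simp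
    rw [preimage_univ, inter_univ, setLIntegral_eq_zero_iff hAm hum] at this
    refine hA0 (measure_mono_null (fun x hx => ?_) this)
    simp only [mem_compl_iff, mem_ofPred_eq, Classical.not_imp]
    exact ⟨hx, ENNReal.coe_ne_zero.2 (tsub_pos_of_lt hx.1).ne'⟩
  have hne₂ : κ₂ ≠ 0 := fun h0 => by
    have : ∫⁻ x in A' ∩ ξ ⁻¹' univ, v x ∂m = 0 := by rw [← hκ₂ _ MeasurableSet.univ, h0]; simp
    rw [preimage_univ, inter_univ, setLIntegral_eq_zero_iff hAm' hvm] at this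
    refine hA0' (measure_mono_null (fun x hx => ?_) this)
    simp only [mem_compl_iff, mem_ofPred_eq, Classical.not_imp]
    exact ⟨hx, ENNReal.coe_ne_zero.2 (tsub_pos_of_lt hx.1).ne'⟩
  obtain ⟨B, hB, hBeq, hB0⟩ := exists_measure_eq_measure_compl κ₁ κ₂ hne₁ hne₂
  set k := κ₁ B with hk
  have hkfin : k ≠ ⊤ := measure_ne_top _ _
  set C := A ∩ ξ ⁻¹' B
  set C' := A' ∩ ξ ⁻¹' Bᶜ
  have hCm : MeasurableSet C := hAm.inter (hξ hB)
  have hCm' : MeasurableSet C' := hAm'.inter (hξ hB.compl)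
  have hdisj : Disjoint C C' :=
    Set.disjoint_left.2 fun x hx hx' => hx'.2 hx.2
  have hk1 : ∫⁻ x in C, u x ∂m = k := (hκ₁ B hB).symm
  have hk2 : ∫⁻ x in C', v x ∂m = k := by rw [hBeq, hκ₂ _ hB.compl]
  have hsplit : ∀ g : X → ℝ≥0∞, Measurable g → ∫⁻ x, g x ∂m =
      (∫⁻ x in C, g x ∂m) + (∫⁻ x in C', g x ∂m) + ∫⁻ x in (C ∪ C')ᶜ, g x ∂m := by
    intro g hg
    rw [← lintegral_union hCm' hdisj, lintegral_add_compl _ (hCm.union hCm')]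
  classical
  set ρ' : X → ℝ≥0 := C.piecewise (fun _ => y) (C'.piecewise (fun _ => y') ρ)
  have hρ' : Measurable ρ' :=
    Measurable.piecewise hCm measurable_const (Measurable.piecewise hCm' measurable_const hρ)
  have e1 : ∀ x ∈ C, ρ' x = y := fun x hx => piecewise_eq_of_mem _ _ _ hx
  have e2 : ∀ x ∈ C', ρ' x = y' := fun x hx => by
    simp only [ρ']
    rw [piecewise_eq_of_notMem _ _ _ fun h => Set.disjoint_left.1 hdisj h hx,
      piecewise_eq_of_mem _ _ _ hx]
  have e3 : ∀ x ∈ (C ∪ C')ᶜ, ρ' x = ρ x := fun x hx => by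
    simp only [ρ']
    rw [piecewise_eq_of_notMem _ _ _ fun h => hx (Or.inl h),
      piecewise_eq_of_notMem _ _ _ fun h => hx (Or.inr h)]
  have hsplit' : ∀ G : X → ℝ≥0 → ℝ≥0∞, Measurable (fun x => G x (ρ' x)) → ∫⁻ x, G x (ρ' x) ∂m =
      (∫⁻ x in C, G x y ∂m) + (∫⁻ x in C', G x y' ∂m) + ∫⁻ x in (C ∪ C')ᶜ, G x (ρ x) ∂m := by
    intro G hG
    rw [hsplit _ hG]
    congr 1
    · congr 1
      · exact setLIntegral_congr_fun hCm fun x hx => by simp only [e1 x hx]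
      · exact setLIntegral_congr_fun hCm' fun x hx => by simp only [e2 x hx]
    · exact setLIntegral_congr_fun (hCm.union hCm').compl fun x hx => by simp only [e3 x hx]
  have hy : ∫⁻ _x in C, (y : ℝ≥0∞) ∂m = (∫⁻ x in C, ρ x ∂m) + k := by
    rw [← hk1, ← lintegral_add_left (by fun_prop)]
    refine setLIntegral_congr_fun hCm fun x hx => ?_
    simp only [hu]
    norm_cast
    rw [add_tsub_cancel_of_le hx.1.1.le]
  have hy' : ∫⁻ x in C', ρ x ∂m = (∫⁻ _x in C', (y' : ℝ≥0∞) ∂m) + k := by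
    rw [← hk2, ← lintegral_add_left (by fun_prop)]
    refine setLIntegral_congr_fun hCm' fun x hx => ?_
    simp only [hv]
    norm_cast
    rw [add_tsub_cancel_of_le hx.1.1.le]
  have hmass : ∫⁻ x, ρ' x ∂m = ∫⁻ x, ρ x ∂m := by
    rw [hsplit' (fun _ t => (t : ℝ≥0∞)) (by fun_prop), hsplit _ (by fun_prop), hy, hy']
    ring
  have hle := hmin ρ' hρ' hmass
  have i1 : (∫⁻ x in C, W x * h y ∂m) + p * (∫⁻ _x in C, (y : ℝ≥0∞) ∂m) ≤
      (∫⁻ x in C, W x * h (ρ x) ∂m) + p * ∫⁻ x in C, ρ x ∂m := by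
    rw [← lintegral_const_mul _ (by fun_prop), ← lintegral_const_mul _ (by fun_prop),
      ← lintegral_add_left (by fun_prop), ← lintegral_add_left (by fun_prop)]
    exact setLIntegral_mono' hCm fun x hx => hx.1.2
  have i2 : (∫⁻ x in C', W x * h y' ∂m) + q * (∫⁻ _x in C', (y' : ℝ≥0∞) ∂m) ≤
      (∫⁻ x in C', W x * h (ρ x) ∂m) + q * ∫⁻ x in C', ρ x ∂m := by
    rw [← lintegral_const_mul _ (by fun_prop), ← lintegral_const_mul _ (by fun_prop),
      ← lintegral_add_left (by fun_prop), ← lintegral_add_left (by fun_prop)]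
    exact setLIntegral_mono' hCm' fun x hx => hx.1.2
  have hs1 := hsplit (fun x => W x * h (ρ x)) (by fun_prop)
  have hs2 := hsplit' (fun x t => W x * h t) (by fun_prop)
  rw [hs2] at hle
  rw [hy] at i1
  rw [hy'] at i2
  have ha : ∫⁻ x in C, ρ x ∂m ≠ ⊤ := hρle _
  have hb : ∫⁻ _x in C', (y' : ℝ≥0∞) ∂m ≠ ⊤ := by
    intro htop
    rw [htop, top_add] at hy'
    exact hρle _ hy'
  set J := ∫⁻ x, W x * h (ρ x) ∂m
  generalize (∫⁻ x in C, W x * h y ∂m) = a1 at *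
  generalize (∫⁻ x in C', W x * h y' ∂m) = a2 at *
  generalize (∫⁻ x in C, W x * h (ρ x) ∂m) = b1 at *
  generalize (∫⁻ x in C', W x * h (ρ x) ∂m) = b2 at *
  generalize (∫⁻ x in (C ∪ C')ᶜ, W x * h (ρ x) ∂m) = r at *
  generalize (∫⁻ x in C, (ρ x : ℝ≥0∞) ∂m) = a at *
  generalize (∫⁻ _x in C', (y' : ℝ≥0∞) ∂m) = b at *
  have hfin : J + p * a + q * b ≠ ⊤ := by finiteness
  -- The swap saves at least `p` per unit of mass added and costs at most `q` per unit removed, so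
  -- minimality would force `p k ≤ q k`, against `q < p`. Finite terms are added to avoid
  -- subtraction in `ℝ≥0∞`.
  have key : J + p * a + q * b + p * k ≤ J + p * a + q * b + q * k := by
    calc J + p * a + q * b + p * k ≤ (a1 + a2 + r) + p * a + q * b + p * k := by gcongr
      _ = (a1 + p * (a + k)) + (a2 + q * b) + r := by ring
      _ ≤ (b1 + p * a) + (b2 + q * (b + k)) + r := by gcongr
      _ = (b1 + b2 + r) + p * a + q * b + q * k := by ring
      _ = J + p * a + q * b + q * k := by rw [← hs1]
  have key2 := (ENNReal.add_le_add_iff_left hfin).1 key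
  rw [ENNReal.mul_le_mul_iff_left hB0 hkfin] at key2
  exact absurd (by exact_mod_cast key2) (not_le.2 hqp)

/-- The Lagrange multiplier rule for a constrained minimizer of `∫ W h(ρ)`, for an atomless
measure and a nonincreasing, possibly nonconvex `h`. -/
lemma exists_multiplier {ξ : X → ℝ} (hξ : Measurable ξ)
    (hξ0 : ∀ t, m (ξ ⁻¹' {t}) = 0) {W : X → ℝ≥0∞} (hW : Measurable W) (hWfin : ∀ x, W x ≠ ⊤)
    {h : ℝ≥0 → ℝ≥0∞} (hh : Antitone h) (hhfin : ∀ y, 0 < y → h y ≠ ⊤) {ρ : X → ℝ≥0}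
    (hρ : Measurable ρ) (hρfin : ∫⁻ x, ρ x ∂m ≠ ⊤) (hρ0 : ∫⁻ x, ρ x ∂m ≠ 0)
    (hJ : ∫⁻ x, W x * h (ρ x) ∂m ≠ ⊤)
    (hmin : ∀ ρ' : X → ℝ≥0, Measurable ρ' → ∫⁻ x, ρ' x ∂m = ∫⁻ x, ρ x ∂m →
      ∫⁻ x, W x * h (ρ x) ∂m ≤ ∫⁻ x, W x * h (ρ' x) ∂m) :
    ∃ c : ℝ≥0, ∀ᵐ x ∂m, ∀ y : ℝ≥0, W x * h (ρ x) + c * ρ x ≤ W x * h y + c * y := by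
  have swap := fun {p q : ℝ≥0} (hqp : q < p) => measure_eq_zero_or_of_minimizer hξ hξ0 hW
    hh.measurable hρ hρfin hJ hmin hqp
  obtain ⟨D, hDc, hDd⟩ := TopologicalSpace.exists_countable_dense ℝ≥0
  set A : ℝ≥0 → ℝ≥0 → Set X :=
    fun p y => {x | ρ x < y ∧ W x * h y + p * y ≤ W x * h (ρ x) + p * ρ x} with hA
  set A' : ℝ≥0 → ℝ≥0 → Set X :=
    fun q y => {x | y < ρ x ∧ W x * h y + q * y ≤ W x * h (ρ x) + q * ρ x} with hA'
  -- The prices at which, on a set of positive measure, raising the density to a common level does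
  -- not increase the penalized cost. The multiplier is their supremum.
  set P : Set ℝ≥0 := {p | ∃ y, m (A p y) ≠ 0}
  have hP0 : (0 : ℝ≥0) ∈ P := by
    by_contra hcon
    have h0 : ∀ y ∈ D, m (A 0 y) = 0 := fun y _ => by
      by_contra h
      exact hcon ⟨y, h⟩
    have h1 : m (⋃ y ∈ D, A 0 y) = 0 := (measure_biUnion_null_iff hDc).2 h0
    have h2 : (univ : Set X) ⊆ ⋃ y ∈ D, A 0 y := fun x _ => by
      obtain ⟨y, hy, hlt, -⟩ := hDd.exists_between (lt_add_one (ρ x))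
      refine mem_biUnion hy ⟨hlt, ?_⟩
      simp only [ENNReal.coe_zero, zero_mul, add_zero]
      gcongr
      exact hh hlt.le
    have h3 : m = 0 := Measure.measure_univ_eq_zero.1 (measure_mono_null h2 h1)
    exact hρ0 (by rw [h3]; simp)
  -- Where `ρ > y > 0`, a sufficiently high price makes lowering to `y` worthwhile, as `W h(y)` is
  -- finite. By the swap lemma such a price bounds `P`.
  have hbdd : ∃ q y, m (A' q y) ≠ 0 := by
    by_contra! hcon
    have h1 : m (⋃ y ∈ D, ⋃ n : ℕ, A' n y) = 0 :=
      (measure_biUnion_null_iff hDc).2 fun y _ => measure_iUnion_null fun n => hcon n y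
    refine hρ0 ?_
    rw [lintegral_eq_zero_iff (by fun_prop)]
    refine measure_mono_null (fun x hx => ?_) h1
    have hx0 : 0 < ρ x := by
      rw [pos_iff_ne_zero]
      intro h
      exact hx (by simp [h])
    obtain ⟨y, hy, hy0, hlt⟩ := hDd.exists_between hx0
    have hWfin' : W x * h y ≠ ⊤ := ENNReal.mul_ne_top (hWfin x) (hhfin y hy0)
    obtain ⟨n, hn⟩ := exists_nat_ge ((W x * h y).toNNReal / (ρ x - y))
    refine mem_biUnion hy (mem_iUnion.2 ⟨n, hlt, ?_⟩)
    rw [div_le_iff₀ (tsub_pos_of_lt hlt)] at hn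
    have h2 : W x * h y ≤ (n : ℝ≥0∞) * ((ρ x - y : ℝ≥0) : ℝ≥0∞) := by
      rw [← ENNReal.coe_toNNReal hWfin']
      exact_mod_cast hn
    calc W x * h y + ((n : ℝ≥0) : ℝ≥0∞) * y
        ≤ (n : ℝ≥0∞) * ((ρ x - y : ℝ≥0) : ℝ≥0∞) + ((n : ℝ≥0) : ℝ≥0∞) * y := by gcongr
      _ = ((n : ℝ≥0) : ℝ≥0∞) * ρ x := by
        norm_cast
        rw [← mul_add, tsub_add_cancel_of_le hlt.le]
      _ ≤ _ := le_add_self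
  obtain ⟨q₀, y₀, hq₀⟩ := hbdd
  have hPb : BddAbove P := ⟨q₀, fun p ⟨y, hy⟩ => by
    by_contra! hlt
    exact (swap hlt y y₀).elim hy hq₀⟩
  set c := sSup P
  have hup : ∀ᵐ x ∂m, ∀ y ∈ D, ∀ n : ℕ, x ∉ A (c + 1 / (n + 1)) y := by
    rw [ae_ball_iff hDc]
    intro y _
    rw [ae_all_iff]
    intro n
    have hn : c + 1 / (n + 1 : ℝ≥0) ∉ P := fun hmem =>
      absurd (le_csSup hPb hmem) (not_le.2 (lt_add_of_pos_right _ (by positivity)))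
    refine measure_eq_zero_iff_ae_notMem.1 ?_
    by_contra h
    exact hn ⟨y, h⟩
  have hdown : ∀ᵐ x ∂m, ∀ y ∈ D, ∀ n : ℕ, c - 1 / (n + 1) < c → x ∉ A' (c - 1 / (n + 1)) y := by
    rw [ae_ball_iff hDc]
    intro y _
    rw [ae_all_iff]
    intro n
    by_cases hlt : c - 1 / (n + 1 : ℝ≥0) < c
    · obtain ⟨p, ⟨z, hz⟩, hp⟩ := exists_lt_of_lt_csSup ⟨0, hP0⟩ hlt
      filter_upwards [measure_eq_zero_iff_ae_notMem.1 ((swap hp z y).resolve_left hz)] with x hx _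
      exact hx
    · exact Eventually.of_forall fun x h => absurd h hlt
  have hlim0 : Tendsto (fun n : ℕ => 1 / ((n : ℝ≥0) + 1)) atTop (𝓝 0) :=
    tendsto_one_div_add_atTop_nhds_zero_nat
  have hpass : ∀ (r : ℕ → ℝ≥0), Tendsto r atTop (𝓝 c) → ∀ (x : X) (y : ℝ≥0),
      (∀ᶠ n in atTop, W x * h (ρ x) + r n * ρ x ≤ W x * h y + r n * y) →
      W x * h (ρ x) + c * ρ x ≤ W x * h y + c * y := by
    intro r hr x y hev
    have hl : ∀ z : ℝ≥0, Tendsto (fun n => ((r n : ℝ≥0∞) * z)) atTop (𝓝 (c * z)) := fun z => by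
      have := ENNReal.tendsto_coe.2 (hr.mul_const z)
      simpa using this
    exact le_of_tendsto_of_tendsto (tendsto_const_nhds.add (hl _)) (tendsto_const_nhds.add (hl _))
      hev
  refine ⟨c, ?_⟩
  filter_upwards [hup, hdown] with x hx hx'
  have hD : ∀ y ∈ D, W x * h (ρ x) + c * ρ x ≤ W x * h y + c * y := by
    intro y hy
    rcases lt_trichotomy (ρ x) y with hlt | heq | hlt
    · refine hpass (fun n => c + 1 / ((n : ℝ≥0) + 1)) (by simpa using hlim0.const_add c) x y
        (Eventually.of_forall fun n => ?_)
      by_contra! hcon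
      exact hx y hy n ⟨hlt, hcon.le⟩
    · rw [heq]
    -- No price lies below `c = 0`; in that case monotonicity of `h` already suffices.
    · rcases eq_or_ne c 0 with hc | hc
      · simp only [hc, ENNReal.coe_zero, zero_mul, add_zero]
        gcongr
        exact hh hlt.le
      · refine hpass (fun n => c - 1 / ((n : ℝ≥0) + 1))
          (by simpa using (tendsto_const_nhds (x := c)).sub hlim0) x y
          (Eventually.of_forall fun n => ?_)
        by_contra! hcon
        exact hx' y hy n (tsub_lt_self (pos_iff_ne_zero.2 hc) (by positivity)) ⟨hlt, hcon.le⟩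
  intro y
  -- An arbitrary `y` is approached by points of `D` from above, where `h` is no larger; continuity
  -- of `h` is not needed.
  refine ENNReal.le_of_forall_pos_le_add fun ε hε _ => ?_
  obtain ⟨z, hz, hyz, hzε⟩ := hDd.exists_between
    (show y < y + ε / (c + 1) from lt_add_of_pos_right _ (by positivity))
  have h1 : (c : ℝ≥0∞) * z ≤ c * y + ε := by
    have : c * z ≤ c * y + ε := by
      calc c * z ≤ c * (y + ε / (c + 1)) := by gcongr
        _ = c * y + ε * (c / (c + 1)) := by ring
        _ ≤ c * y + ε * 1 := by
          gcongr
          exact div_le_one_of_le₀ le_self_add (by positivity)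
        _ = _ := by rw [mul_one]
    exact_mod_cast this
  calc _ ≤ W x * h z + c * z := hD z hz
    _ ≤ W x * h y + (c * y + ε) := by
      gcongr
      exact hh hyz.le
    _ = _ := by ring

end Multiplier

/-! ### The profile `h` and its zero set. -/

section Profile

open scoped NNReal

variable {d : ℕ} {α : ℝ}

/-- The integrand `y^{-2/d} θ⁻(α y^{1/d})` of the limit functional, for a finite density `y`. -/
def profile (d : ℕ) (α : ℝ) (y : ℝ≥0) : ℝ≥0∞ :=
  ((y : ℝ≥0∞) ^ (2 / (d : ℝ)))⁻¹ * thetaMinus d (α * (y : ℝ) ^ (1 / (d : ℝ)))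

lemma thetaMinus_anti : Antitone (thetaMinus d) := fun _ _ hab =>
  iSup_mono fun _ => iSup_mono' fun h => ⟨hab.trans_lt h, le_rfl⟩

lemma profile_antitone (hα : 0 < α) : Antitone (profile d α) := by
  intro y z hyz
  refine mul_le_mul' (ENNReal.inv_le_inv.2 ?_) (thetaMinus_anti ?_)
  · gcongr
  · gcongr

lemma profile_ne_top (hd : 1 ≤ d) (hα : 0 < α) (y : ℝ≥0) (hy : 0 < y) : profile d α y ≠ ⊤ := by
  refine ENNReal.mul_ne_top ?_ ?_
  · rw [ENNReal.inv_ne_top, ← ENNReal.coe_rpow_of_ne_zero hy.ne']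
    exact ENNReal.coe_ne_zero.2 (NNReal.rpow_pos hy).ne'
  · have : 0 < α * (y : ℝ) ^ (1 / (d : ℝ)) := by positivity
    rw [← theta_eq_thetaMinus hd this]
    exact (theta_lt_top hd this).ne

lemma t₁_le {b : ℝ} (hb : 0 < b) (h : theta d b = 0) : t₁ d ≤ b :=
  csInf_le ⟨0, fun _ ht => ht.1.le⟩ ⟨hb, h⟩

lemma theta_eq_zero_of_t₁_lt (hd : 1 ≤ d) (ht : 0 < t₁ d) {b : ℝ} (hb : t₁ d < b) :
    theta d b = 0 := by
  -- The infimum of the empty set is `0` by convention, so `t₁ > 0` guarantees that zeros exist.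
  have hne : {t : ℝ | 0 < t ∧ theta d t = 0}.Nonempty := by
    by_contra h
    rw [not_nonempty_iff_eq_empty] at h
    rw [t₁, h, Real.sInf_empty] at ht
    exact lt_irrefl _ ht
  obtain ⟨t, ⟨ht0, htz⟩, htb⟩ := exists_lt_of_csInf_lt hne hb
  exact le_antisymm (htz ▸ theta_anti hd ht0 htb.le) bot_le

/-- The supremum runs over `β > t₁` only, so the value of `θ` at `t₁` itself is irrelevant. -/
lemma thetaMinus_t₁ (hd : 1 ≤ d) (ht : 0 < t₁ d) : thetaMinus d (t₁ d) = 0 := by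
  simp only [thetaMinus, ENNReal.iSup_eq_zero]
  exact fun b hb => theta_eq_zero_of_t₁_lt hd ht hb

lemma t₁_le_of_thetaMinus_eq_zero {a : ℝ} (ha : 0 ≤ a) (h : thetaMinus d a = 0) : t₁ d ≤ a := by
  refine le_of_forall_gt_imp_ge_of_dense fun b hb => t₁_le (ha.trans_lt hb) ?_
  simp only [thetaMinus, ENNReal.iSup_eq_zero] at h
  exact h b hb

lemma profile_zero (hd : 1 ≤ d) (ht : 0 < t₁ d) : profile d α 0 = ⊤ := by
  have hd' : (0 : ℝ) < d := by exact_mod_cast hd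
  have h1 : thetaMinus d 0 ≠ 0 := fun h => not_le.2 ht (t₁_le_of_thetaMinus_eq_zero le_rfl h)
  rw [profile, ENNReal.coe_zero, ENNReal.zero_rpow_of_pos (by positivity), ENNReal.inv_zero,
    NNReal.coe_zero, Real.zero_rpow (by positivity), mul_zero, ENNReal.top_mul h1]

lemma thetaMinus_eq_zero_of_profile (hd : 1 ≤ d) {y : ℝ≥0} (h : profile d α y = 0) :
    thetaMinus d (α * (y : ℝ) ^ (1 / (d : ℝ))) = 0 := by
  refine (mul_eq_zero.1 h).resolve_left ?_
  rw [ENNReal.inv_eq_zero]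
  exact ENNReal.rpow_ne_top_of_nonneg (by positivity) ENNReal.coe_ne_top

lemma le_of_profile_eq_zero (hd : 1 ≤ d) (hα : 0 < α) {y : ℝ≥0} (ht : 0 < t₁ d)
    (h : profile d α y = 0) : (t₁ d / α) ^ d ≤ y := by
  have h1 := t₁_le_of_thetaMinus_eq_zero (by positivity) (thetaMinus_eq_zero_of_profile hd h)
  have h2 : ((y : ℝ) ^ (1 / (d : ℝ))) ^ d = y := by
    rw [one_div]
    exact Real.rpow_inv_natCast_pow y.2 (by omega)
  rw [← h2]
  gcongr
  rw [div_le_iff₀ hα]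
  linarith

lemma profile_threshold (hd : 1 ≤ d) (hα : 0 < α) (ht : 0 < t₁ d) {y : ℝ≥0}
    (hy : (y : ℝ) = (t₁ d / α) ^ d) : profile d α y = 0 := by
  have h1 : α * (y : ℝ) ^ (1 / (d : ℝ)) = t₁ d := by
    rw [hy, one_div, Real.pow_rpow_inv_natCast (by positivity) (by omega)]
    field_simp
  rw [profile, h1, thetaMinus_t₁ hd ht, mul_zero]

/-- The factor `y^{-2/d}` decreases strictly, so a flat stretch is possible only where the other
factor is zero. -/
lemma profile_eq_zero_of_add_eq (hd : 1 ≤ d) (hα : 0 < α) (ht : 0 < t₁ d) {y e : ℝ≥0} (he : 0 < e)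
    (h : profile d α (y + e) = profile d α y) : profile d α y = 0 := by
  have hd' : (0 : ℝ) < d := by exact_mod_cast hd
  rcases eq_or_ne y 0 with rfl | hy
  · exact absurd (profile_zero hd ht) (h ▸ profile_ne_top hd hα _ (by simpa using he))
  have hy0 : 0 < y := pos_iff_ne_zero.2 hy
  by_contra hne
  have hθ : thetaMinus d (α * (y : ℝ) ^ (1 / (d : ℝ))) ≠ 0 := fun h0 => hne (by rw [profile, h0, mul_zero])
  have hθ' : thetaMinus d (α * (y : ℝ) ^ (1 / (d : ℝ))) ≠ ⊤ := by
    have : 0 < α * (y : ℝ) ^ (1 / (d : ℝ)) := by positivity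
    rw [← theta_eq_thetaMinus hd this]
    exact (theta_lt_top hd this).ne
  have h1 : profile d α (y + e) < profile d α y := by
    calc profile d α (y + e) ≤ (((y + e : ℝ≥0) : ℝ≥0∞) ^ (2 / (d : ℝ)))⁻¹ *
          thetaMinus d (α * (y : ℝ) ^ (1 / (d : ℝ))) := by
          refine mul_le_mul_right (thetaMinus_anti ?_) _
          gcongr
          simp
      _ < ((y : ℝ≥0∞) ^ (2 / (d : ℝ)))⁻¹ * thetaMinus d (α * (y : ℝ) ^ (1 / (d : ℝ))) := by
          rw [ENNReal.mul_lt_mul_iff_left hθ hθ', ENNReal.inv_lt_inv]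
          refine ENNReal.rpow_lt_rpow ?_ (by positivity)
          exact_mod_cast lt_add_of_pos_right y he
  exact h1.ne h

/-- Right continuity enters here, to identify the `θ` of `g` with the `θ⁻` of the functional. -/
lemma g_eq_profile (hd : 1 ≤ d) (hα : 0 < α) {y : ℝ≥0} (hy : 0 < y) :
    g d α y = (profile d α y : EReal) := by
  have hy' : (0 : ℝ) < y := hy
  rw [g, if_pos hy', profile, theta_eq_thetaMinus hd (by positivity),
    ← ENNReal.ofReal_rpow_of_pos hy', ENNReal.ofReal_coe_nnreal, ENNReal.rpow_neg]

end Profile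

/-! ### Densities of competitors and the pointwise optimality condition. -/

section Main

open scoped NNReal

variable {d : ℕ} {α : ℝ} {Ω : Set (EuclideanSpace ℝ (Fin d))} {f : EuclideanSpace ℝ (Fin d) → ℝ}

lemma limitFunctional_eq {μ : Measure (EuclideanSpace ℝ (Fin d))}
    {ρ : EuclideanSpace ℝ (Fin d) → ℝ≥0}
    (hρ : ∀ᵐ x ∂volume.restrict Ω, μ.rnDeriv volume x = ρ x) :
    limitFunctional α f Ω μ = ∫⁻ x in Ω, ENNReal.ofReal (f x ^ 2) * profile d α (ρ x) := by
  refine lintegral_congr_ae ?_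
  filter_upwards [hρ] with x hx
  simp only [hx, profile, ENNReal.coe_toReal, div_eq_mul_inv, mul_assoc]

lemma isProbOn_withDensity {ρ : EuclideanSpace ℝ (Fin d) → ℝ≥0} (hΩ : MeasurableSet Ω)
    (h : ∫⁻ x in Ω, ρ x = 1) :
    IsProbOn Ω ((volume.restrict Ω).withDensity fun x => (ρ x : ℝ≥0∞)) := by
  refine ⟨⟨by rw [withDensity_apply _ MeasurableSet.univ, setLIntegral_univ, h]⟩, ?_⟩
  refine withDensity_absolutelyContinuous _ _ ?_
  rw [Measure.restrict_apply' hΩ]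
  exact measure_mono_null (fun x hx => hx.1 (subset_closure hx.2)) measure_empty

lemma limitFunctional_withDensity {ρ : EuclideanSpace ℝ (Fin d) → ℝ≥0} (hρ : Measurable ρ)
    (hΩ : MeasurableSet Ω) :
    limitFunctional α f Ω ((volume.restrict Ω).withDensity fun x => (ρ x : ℝ≥0∞)) =
      ∫⁻ x in Ω, ENNReal.ofReal (f x ^ 2) * profile d α (ρ x) := by
  refine limitFunctional_eq ?_
  have h1 : Measurable (Ω.indicator fun x => (ρ x : ℝ≥0∞)) :=
    (measurable_coe_nnreal_ennreal.comp hρ).indicator hΩ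
  have h2 := Measure.rnDeriv_withDensity volume h1
  rw [withDensity_indicator hΩ] at h2
  filter_upwards [ae_restrict_of_ae h2, ae_restrict_mem hΩ] with x hx hxΩ
  rw [hx, indicator_of_mem hxΩ]

/-- Vanishing of the profile forces `ρ ≥ (t₁/α)^d` on `{f > 0}`, and the bound on `α` says that this
density times the volume of `{f > 0}` exceeds one. -/
lemma one_lt_lintegral_of_profile_eq_zero (hd : 1 ≤ d) (hα : 0 < α) (hΩ : MeasurableSet Ω)
    (hΩf : volume Ω ≠ ⊤) (ht : 0 < t₁ d)
    (hαt : α < (volume.real {x ∈ Ω | 0 < f x}) ^ (1 / (d : ℝ)) * t₁ d)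
    {ρ : EuclideanSpace ℝ (Fin d) → ℝ≥0} (hρ : Measurable ρ)
    (h : ∀ᵐ x ∂volume.restrict Ω, 0 < f x → profile d α (ρ x) = 0) :
    1 < ∫⁻ x in Ω, ρ x := by
  set T : ℝ := (t₁ d / α) ^ d
  have hAf : volume {x ∈ Ω | 0 < f x} ≠ ⊤ := measure_ne_top_of_subset (fun x hx => hx.1) hΩf
  have hpow : ((volume.real {x ∈ Ω | 0 < f x}) ^ (1 / (d : ℝ))) ^ d =
      volume.real {x ∈ Ω | 0 < f x} := by
    rw [one_div]
    exact Real.rpow_inv_natCast_pow measureReal_nonneg (by omega)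
  have h1 : 1 < T * volume.real {x ∈ Ω | 0 < f x} := by
    rw [← hpow, ← mul_pow]
    refine one_lt_pow₀ ?_ (by omega)
    rw [div_mul_eq_mul_div, one_lt_div hα]
    linarith
  calc (1 : ℝ≥0∞) = ENNReal.ofReal 1 := ENNReal.ofReal_one.symm
    _ < ENNReal.ofReal (T * volume.real {x ∈ Ω | 0 < f x}) :=
      (ENNReal.ofReal_lt_ofReal_iff (by linarith)).2 h1
    _ = ENNReal.ofReal T * volume.restrict Ω {x ∈ Ω | 0 < f x} := by
      rw [ENNReal.ofReal_mul (by positivity), measureReal_def, ENNReal.ofReal_toReal hAf,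
        Measure.restrict_apply' hΩ, inter_eq_left.2 fun x hx => hx.1]
    _ ≤ ENNReal.ofReal T * volume.restrict Ω {x | ENNReal.ofReal T ≤ (ρ x : ℝ≥0∞)} := by
      gcongr 1
      refine measure_mono_ae ?_
      filter_upwards [h] with x hx hxA
      have := le_of_profile_eq_zero hd hα ht (hx hxA.2)
      exact ENNReal.ofReal_le_of_le_toReal (by simpa using this)
    _ ≤ ∫⁻ x in Ω, ρ x := mul_meas_ge_le_lintegral (by fun_prop) _

/-- The pointwise optimality condition in terms of the subdifferential of `g`. -/
lemma mem_negSubdiffInv (hd : 1 ≤ d) (hα : 0 < α) (ht : 0 < t₁ d) {w : ℝ} (hw : 0 < w) {c z : ℝ≥0}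
    (h : ∀ y : ℝ≥0, ENNReal.ofReal w * profile d α z + c * z ≤
      ENNReal.ofReal w * profile d α y + c * y) :
    (z : ℝ) ∈ negSubdiffInv (g d α) (c / w) := by
  have hw0 : ENNReal.ofReal w ≠ 0 := by simpa using hw
  have hzfin : profile d α z ≠ ⊤ := by
    intro htop
    have h1 := h 1
    rw [htop, ENNReal.mul_top hw0, top_add, top_le_iff] at h1
    exact ENNReal.add_ne_top.2 ⟨ENNReal.mul_ne_top ENNReal.ofReal_ne_top
      (profile_ne_top hd hα 1 one_pos), by finiteness⟩ h1
  have hz : 0 < z := by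
    rw [pos_iff_ne_zero]
    rintro rfl
    exact hzfin (profile_zero hd ht)
  have hcoe : ∀ y : ℝ≥0, profile d α y ≠ ⊤ →
      ((profile d α y : ℝ≥0∞) : EReal) = (((profile d α y).toReal : ℝ) : EReal) := fun y hy =>
    (EReal.coe_toReal (by simpa using hy) (EReal.coe_ennreal_ne_bot _)).symm.trans (by simp)
  refine ⟨z.2, ?_, ?_, fun y => ?_⟩
  · rw [g_eq_profile hd hα hz]
    simpa using hzfin
  · rw [g_eq_profile hd hα hz]
    exact EReal.coe_ennreal_ne_bot _
  · by_cases hy : 0 < y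
    · lift y to ℝ≥0 using hy.le
      have hyfin := profile_ne_top hd hα y hy
      rw [g_eq_profile hd hα hz, g_eq_profile hd hα hy, hcoe z hzfin, hcoe y hyfin]
      have h1 := ENNReal.toReal_mono (by finiteness) (h y)
      rw [ENNReal.toReal_add (by finiteness) (by finiteness),
        ENNReal.toReal_add (by finiteness) (by finiteness)] at h1
      simp only [ENNReal.toReal_mul, ENNReal.toReal_ofReal hw.le, ENNReal.coe_toReal] at h1
      have h2 : (profile d α z).toReal + -(c / w) * (y - z) ≤ (profile d α y).toReal := by
        rw [← mul_le_mul_iff_right₀ hw]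
        have h3 : w * ((profile d α z).toReal + -(c / w) * (y - z)) =
            w * (profile d α z).toReal - c * (y - z) := by field_simp; ring
        rw [h3]
        linarith
      exact_mod_cast h2
    · rw [g, g, if_neg hy]
      exact le_top

end Main

end ComplianceLocation

end

/-! ### The theorem. -/

open ComplianceLocation in
theorem theorem2p3 {d : ℕ} (hd : 1 ≤ d) (Ω : Set (EuclideanSpace ℝ (Fin d)))
    (hΩ : IsOpen Ω) (hΩb : Bornology.IsBounded Ω)
    (f : EuclideanSpace ℝ (Fin d) → ℝ) (hf : MemLp f 2 (volume.restrict Ω))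
    (hf0 : ∀ᵐ x ∂(volume.restrict Ω), 0 ≤ f x)
    (α : ℝ) (hα : 0 < α)
    (hαt : α < (volume.real {x ∈ Ω | 0 < f x}) ^ (1 / (d : ℝ)) * ComplianceLocation.t₁ d)
    (μ : Measure (EuclideanSpace ℝ (Fin d)))
    (hμ : ComplianceLocation.IsMinimizer α f Ω μ) :
    μ ≪ volume.restrict Ω ∧
    ∃ ρ : EuclideanSpace ℝ (Fin d) → ℝ, Measurable ρ ∧ (∀ x, 0 ≤ ρ x) ∧
      μ = (volume.restrict Ω).withDensity (fun x => ENNReal.ofReal (ρ x)) ∧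
      (∃ c : ℝ, 0 < c ∧
        (∀ᵐ x ∂(volume.restrict Ω), 0 < f x →
          ρ x ∈ ComplianceLocation.negSubdiffInv (ComplianceLocation.g d α) (c / f x ^ 2)) ∧
        (∀ᵐ x ∂(volume.restrict Ω), f x = 0 → ρ x = 0)) ∧
      (∀ᵐ x ∂(volume.restrict Ω), ρ x ≤ (ComplianceLocation.t₁ d / α) ^ d) := by
  have hΩm := hΩ.measurableSet
  have hΩf : volume Ω ≠ ⊤ := hΩb.measure_lt_top.ne
  have : IsFiniteMeasure (volume.restrict Ω) := isFiniteMeasure_restrict.2 hΩf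
  have hd' : (0 : ℝ) < d := by exact_mod_cast hd
  obtain ⟨⟨hprob, hμcl⟩, hmin⟩ := hμ
  have hApos : 0 < volume.real {x ∈ Ω | 0 < f x} := by
    refine lt_of_le_of_ne measureReal_nonneg fun h => ?_
    rw [← h, Real.zero_rpow (by positivity), zero_mul] at hαt
    exact lt_asymm hα hαt
  have ht : 0 < ComplianceLocation.t₁ d := by
    by_contra! hcon
    have : (volume.real {x ∈ Ω | 0 < f x}) ^ (1 / (d : ℝ)) * ComplianceLocation.t₁ d ≤ 0 :=
      mul_nonpos_of_nonneg_of_nonpos (by positivity) hcon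
    linarith
  have hΩ0 : volume Ω ≠ 0 := fun h => by
    have : volume.real {x ∈ Ω | 0 < f x} = 0 := by
      rw [measureReal_def, measure_mono_null (fun x hx => hx.1) h, ENNReal.toReal_zero]
    exact hApos.ne' this
  set f' := hf.1.mk f
  have hff' : f =ᵐ[volume.restrict Ω] f' := hf.1.ae_eq_mk
  set W : EuclideanSpace ℝ (Fin d) → ℝ≥0∞ := fun x => ENNReal.ofReal (f' x ^ 2)
  have hW : Measurable W := (hf.1.stronglyMeasurable_mk.measurable.pow_const 2).ennreal_ofReal
  have hWf : ∀ᵐ x ∂volume.restrict Ω, ENNReal.ofReal (f x ^ 2) = W x := by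
    filter_upwards [hff'] with x hx
    simp only [W, hx]
  have hWae : ∀ F : EuclideanSpace ℝ (Fin d) → ℝ≥0∞,
      ∫⁻ x in Ω, ENNReal.ofReal (f x ^ 2) * F x = ∫⁻ x in Ω, W x * F x := fun F => by
    refine lintegral_congr_ae ?_
    filter_upwards [hWf] with x hx
    rw [hx]
  have hWint : ∫⁻ x in Ω, W x ≠ ⊤ := by
    have h1 : ∫⁻ x in Ω, W x = ∫⁻ x in Ω, ENNReal.ofReal (f x ^ 2) := by
      simpa using (hWae fun _ => 1).symm
    rw [h1]
    exact hf.integrable_sq.lintegral_lt_top.ne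
  set ρ : EuclideanSpace ℝ (Fin d) → NNReal := fun x => (μ.rnDeriv volume x).toNNReal
  have hρm : Measurable ρ := (Measure.measurable_rnDeriv μ volume).ennreal_toNNReal
  have hρ : ∀ᵐ x ∂(volume : Measure (EuclideanSpace ℝ (Fin d))), μ.rnDeriv volume x = ρ x := by
    filter_upwards [Measure.rnDeriv_lt_top μ volume] with x hx
    exact (ENNReal.coe_toNNReal hx.ne).symm
  have hρle : (volume.restrict Ω).withDensity (fun x => (ρ x : ℝ≥0∞)) ≤ μ := by
    rw [← withDensity_congr_ae (ae_restrict_of_ae hρ), ← restrict_withDensity hΩm]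
    exact Measure.restrict_le_self.trans (Measure.withDensity_rnDeriv_le μ volume)
  have hmass : ∫⁻ x in Ω, ρ x ≤ 1 := by
    have := hρle univ
    rwa [withDensity_apply _ MeasurableSet.univ, setLIntegral_univ, measure_univ] at this
  have hJle : ∀ σ : EuclideanSpace ℝ (Fin d) → NNReal, Measurable σ → ∫⁻ x in Ω, σ x = 1 →
      ∫⁻ x in Ω, W x * profile d α (ρ x) ≤ ∫⁻ x in Ω, W x * profile d α (σ x) := by
    intro σ hσ hσ1
    have := hmin _ (isProbOn_withDensity hΩm hσ1)
    rwa [limitFunctional_withDensity hσ hΩm, limitFunctional_eq (ae_restrict_of_ae hρ), hWae,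
      hWae] at this
  have hprof := profile_antitone (d := d) hα
  have hJfin : ∫⁻ x in Ω, W x * profile d α (ρ x) ≠ ⊤ := by
    -- The uniform density is a competitor of finite cost.
    set e : NNReal := (volume Ω).toNNReal⁻¹
    have he : 0 < e := inv_pos.2 (ENNReal.toNNReal_pos hΩ0 hΩf)
    have h1 : ∫⁻ _x in Ω, (e : ℝ≥0∞) = 1 := by
      rw [setLIntegral_const, ENNReal.coe_inv (ENNReal.toNNReal_pos hΩ0 hΩf).ne',
        ENNReal.coe_toNNReal hΩf, ENNReal.inv_mul_cancel hΩ0 hΩf]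
    refine ((hJle (fun _ => e) measurable_const h1).trans_lt ?_).ne
    rw [lintegral_mul_const _ hW]
    exact ENNReal.mul_lt_top hWint.lt_top (profile_ne_top hd hα e he).lt_top
  have hnonzero : ¬ ∀ᵐ x ∂volume.restrict Ω, 0 < f x → profile d α (ρ x) = 0 := fun h =>
    not_lt.2 hmass (one_lt_lintegral_of_profile_eq_zero hd hα hΩm hΩf ht hαt hρm h)
  have hWpos : ∀ᵐ x ∂volume.restrict Ω, 0 < f x → W x ≠ 0 := by
    filter_upwards [hWf] with x hx h0
    rw [← hx]
    simpa using h0.ne'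
  -- Missing mass would be spread uniformly as the constant `e`; minimality then makes `profile`
  -- flat between `ρ` and `ρ + e` a.e. on `{f > 0}`, hence zero there.
  have hmass1 : ∫⁻ x in Ω, ρ x = 1 := by
    by_contra hne
    have hlt : ∫⁻ x in Ω, ρ x < 1 := lt_of_le_of_ne hmass hne
    have hdef : (1 - ∫⁻ x in Ω, ρ x) / volume Ω ≠ ⊤ := ENNReal.div_ne_top (by finiteness) hΩ0
    set e : NNReal := ((1 - ∫⁻ x in Ω, ρ x) / volume Ω).toNNReal
    have he : 0 < e := ENNReal.toNNReal_pos
      (ENNReal.div_ne_zero.2 ⟨(tsub_pos_of_lt hlt).ne', hΩf⟩) hdef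
    have h1 : ∫⁻ x in Ω, ((ρ x + e : NNReal) : ℝ≥0∞) = 1 := by
      simp only [ENNReal.coe_add]
      rw [lintegral_add_left (by fun_prop), setLIntegral_const, ENNReal.coe_toNNReal hdef,
        ENNReal.div_mul_cancel hΩ0 hΩf, add_tsub_cancel_of_le hmass]
    have h2 := hJle (fun x => ρ x + e) (by fun_prop) h1
    have hm2 : Measurable fun x => profile d α (ρ x + e) :=
      hprof.measurable.comp (by fun_prop)
    have hm1 : Measurable fun x => profile d α (ρ x) := hprof.measurable.comp hρm
    have h3 : (fun x => W x * profile d α (ρ x + e)) ≤ᵐ[volume.restrict Ω]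
        fun x => W x * profile d α (ρ x) := Eventually.of_forall fun x => by
      dsimp only
      gcongr
      exact hprof le_self_add
    have h4 := ae_eq_of_ae_le_of_lintegral_le h3
      ((lintegral_mono_ae h3).trans_lt hJfin.lt_top).ne (hW.mul hm1).aemeasurable h2
    refine hnonzero ?_
    filter_upwards [h4, hWpos] with x hx hx0 hfx
    refine profile_eq_zero_of_add_eq hd hα ht he ?_
    exact (ENNReal.mul_right_inj (hx0 hfx) ENNReal.ofReal_ne_top).1 hx
  have hμeq : μ = (volume.restrict Ω).withDensity (fun x => (ρ x : ℝ≥0∞)) := by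
    have := isProbOn_withDensity hΩm hmass1
    have := this.1
    refine (Measure.eq_of_le_of_measure_univ_eq hρle ?_).symm
    rw [measure_univ, measure_univ]
  have hnt : Nontrivial (EuclideanSpace ℝ (Fin d)) := by
    have : Nonempty (Fin d) := ⟨⟨0, hd⟩⟩
    infer_instance
  -- The norm serves as `ξ`: its level sets are spheres, null in positive dimension.
  obtain ⟨c, hc⟩ := exists_multiplier (m := volume.restrict Ω) (ξ := fun x => ‖x‖) measurable_norm
    (fun t => by
      refine Measure.absolutelyContinuous_of_le Measure.restrict_le_self ?_
      have : (fun x : EuclideanSpace ℝ (Fin d) => ‖x‖) ⁻¹' {t} = Metric.sphere 0 t := by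
        ext x; simp
      rw [this]
      exact Measure.addHaar_sphere _ _ _)
    hW (fun x => ENNReal.ofReal_ne_top) hprof (fun y hy => profile_ne_top hd hα y hy) hρm
    (by rw [hmass1]; simp) (by rw [hmass1]; simp) hJfin
    fun σ hσ hσ1 => hJle σ hσ (hσ1.trans hmass1)
  set T : NNReal := ⟨(ComplianceLocation.t₁ d / α) ^ d, by positivity⟩
  have hT : profile d α T = 0 := profile_threshold hd hα ht rfl
  have hc0 : 0 < c := by
    rw [pos_iff_ne_zero]
    rintro rfl
    refine hnonzero ?_
    filter_upwards [hc, hWpos] with x hx hx0 hfx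
    have := hx T
    simp only [hT, mul_zero, ENNReal.coe_zero, zero_mul, add_zero, nonpos_iff_eq_zero] at this
    exact (mul_eq_zero.1 this).resolve_left (hx0 hfx)
  have hcne : (c : ℝ≥0∞) ≠ 0 := ENNReal.coe_ne_zero.2 hc0.ne'
  refine ⟨hμeq ▸ withDensity_absolutelyContinuous _ _, fun x => ρ x, by fun_prop,
    fun x => (ρ x).2, ?_, ⟨c, hc0, ?_, ?_⟩, ?_⟩
  · simpa only [ENNReal.ofReal_coe_nnreal] using hμeq
  · filter_upwards [hc, hWf] with x hx hxW hfx
    refine mem_negSubdiffInv hd hα ht (pow_pos hfx 2) ?_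
    rwa [hxW]
  · filter_upwards [hc, hWf] with x hx hxW hfx
    have h0 : W x = 0 := by rw [← hxW, hfx]; simp
    have := hx 0
    simp only [h0, zero_mul, zero_add, ENNReal.coe_zero, mul_zero, nonpos_iff_eq_zero] at this
    simpa using (mul_eq_zero.1 this).resolve_left hcne
  -- Comparison with `T`, where the profile vanishes, gives `c ρ ≤ W h(ρ) + c ρ ≤ c T`.
  · filter_upwards [hc] with x hx
    have h1 := hx T
    rw [hT, mul_zero, zero_add] at h1
    have h2 := (ENNReal.mul_le_mul_iff_right hcne ENNReal.coe_ne_top).1 (le_add_self.trans h1)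
    exact_mod_cast h2
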